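/- Let $\mathbf X_t$, $t\in\mathbb Z$, be a $d$-dimensional complex, zero-mean, weakly stationary time series on a probability space that has constant rank $r$, $1\le r\le d$: it has an integrable, non-negative definite spectral density $\mathbf f$ on $[-\pi,\pi]$, so that $\mathbb E(\mathbf X_{t+h}\mathbf X_t^*)=\int_{-\pi}^{\pi}e^{ih\omega}\mathbf f(\omega)\,d\omega$ for all $t,h\in\mathbb Z$, and $\operatorname{rank}\mathbf f(\omega)=r$ for a.e. $\omega$. Let $$\mathbf f(\omega)=\tilde{\mathbf U}_r(\omega)\,\mathrm{diag}[\lambda_1(\omega),\dots,\lambda_r(\omega)]\,\tilde{\mathbf U}_r^*(\omega)\quad\text{for a.e. }\omega\in[-\pi,\pi]$$ be a measurable spectral decomposition, where $\lambda_1(\omega)\ge\dots\ge\lambda_r(\omega)>0=\lambda_{r+1}(\omega)=\dots=\lambda_d(\omega)$ are the eigenvalues of $\mathbf f(\omega)$ and $\tilde{\mathbf U}_r(\omega)\in\mathbb C^{d\times r}$ has orthonormal columns; $\tilde{\mathbf U}_k$ denotes the matrix of its first $k$ columns. Write $\|\mathbf V\|^2=\mathbb E(\mathbf V^*\mathbf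 V)$ for a square integrable random vector $\mathbf V$. Then $\mathbf X$ has a Cramér representation $\mathbf X_t=\int_{-\pi}^{\pi}e^{it\omega}\,d\mathbf Z_\omega$, $t\in\mathbb Z$, with a unique random spectral measure $\mathbf Z$, that is, an $L^2$-valued vector measure with $\mathbb E(\mathbf Z(A)\mathbf Z(B)^*)=\int_{A\cap B}\mathbf f(\omega)\,d\omega$ for all Borel sets $A,B$ (where $\mathbf f=0$ outside $[-\pi,\pi]$). Let $1\le k\le r$. (a) The process $$\mathbf X_t^{(k)}=\int_{-\pi}^{\pi}e^{it\omega}\,\tilde{\mathbf U}_k(\omega)\tilde{\mathbf U}_k^*(\omega)\,d\mathbf Z_\omega,\qquad t\in\mathbb Z,$$ is well defined and of constant rank $k$, its transfer function $\tilde{\mathbf U}_k\tilde{\mathbf U}_k^*$ has rank $k$ a.e., and it minimizes the mean square error among the linear transforms of $\mathbf X$ of rank at most $k$: for every process $\mathbf Y_t=\int_{-\pi}^{\pi}e^{it\omega}\mathbf T(\omega)\,d\mathbf Z_\omega$, $t\in\mathbb Z$, with a measurable transfer function $\mathbf T$ satisfying $\operatorname{tr}\int_{-\pi}^{\pi}\mathbf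 T\mathbf f\mathbf T^*\,d\omega<\infty$, such that the spectral density of $\mathbf Y$ has rank at most $k$ a.e. (in particular, if $\mathbf Y$ has constant rank $k$) or $\operatorname{rank}\mathbf T(\omega)\le k$ a.e., one has $\|\mathbf X_t-\mathbf X^{(k)}_t\|^2\le\|\mathbf X_t-\mathbf Y_t\|^2$ for all $t\in\mathbb Z$. (b) The functions $\sum_{j=1}^r\lambda_j$ and $\sum_{j=k+1}^r\lambda_j$ are integrable on $[-\pi,\pi]$, and for all $t\in\mathbb Z$ we have $\|\mathbf X_t\|>0$, $$\|\mathbf X_t-\mathbf X_t^{(k)}\|^2=\int_{-\pi}^{\pi}\sum_{j=k+1}^r\lambda_j(\omega)\,d\omega\qquad\text{and}\qquad\frac{\|\mathbf X_t-\mathbf X_t^{(k)}\|^2}{\|\mathbf X_t\|^2}=\frac{\int_{-\pi}^{\pi}\sum_{j=k+1}^r\lambda_j(\omega)\,d\omega}{\int_{-\pi}^{\pi}\sum_{j=1}^r\lambda_j(\omega)\,d\omega}.$$ (c) If $\Delta>\epsilon$ are real numbers with $\lambda_k(\omega)\ge\Delta>\epsilon\ge\lambda_{k+1}(\omega)$ for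 a.e. $\omega\in[-\pi,\pi]$ (if $k=d$, $\lambda_{d+1}$ may be taken to be any real function), then for all $t\in\mathbb Z$ $$\|\mathbf X_t-\mathbf X_t^{(k)}\|\le\bigl(2\pi(r-k)\epsilon\bigr)^{1/2}\qquad\text{and}\qquad\frac{\|\mathbf X_t-\mathbf X_t^{(k)}\|}{\|\mathbf X_t\|}\le\Bigl(\frac{(r-k)\epsilon}{k\Delta}\Bigr)^{1/2},$$ where the last bound is read as $0$ if $k=r$. -/

import Mathlib

open MeasureTheory Filter Topology
open scoped ENNReal Matrix ComplexOrder

namespace RankReduction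

/-- The Hilbert space `L²_d(Ω, 𝓕, P)` of square integrable random vectors with values in `ℂ^d`;
its norm is `‖V‖² = E (V^* V)`. -/
noncomputable abbrev L2Vec {Ω : Type*} [MeasurableSpace Ω] (P : Measure Ω) (d : ℕ) : Type _ :=
  Lp (EuclideanSpace ℂ (Fin d)) 2 P

/-- The frequency interval `[-π, π]`. -/
abbrev freq : Set ℝ := Set.Icc (-Real.pi) Real.pi

/-- The matrix `E (V W^*)`. -/
noncomputable def crossCov {Ω : Type*} [MeasurableSpace Ω] {P : Measure Ω} {d : ℕ}
    (V W : L2Vec P d) : Matrix (Fin d) (Fin d) ℂ :=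
  Matrix.of fun a b => ∫ x, V x a * star (W x b) ∂P

/-- A (zero mean) weakly stationary `d`-dimensional time series. -/
structure IsStationary {Ω : Type*} [MeasurableSpace Ω] {P : Measure Ω} {d : ℕ}
    (X : ℤ → L2Vec P d) : Prop where
  mean_zero : ∀ t, ∫ x, X t x ∂P = 0
  cov_shift : ∀ s t h, crossCov (X (s + h)) (X s) = crossCov (X (t + h)) (X t)

/-- `f` is a spectral density of `X`: an integrable, a.e. non-negative definite matrix function
on `[-π, π]` with `E (X_{t+h} X_t^*) = ∫ e^{ihω} f(ω) dω` for all `t`, `h`. -/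
structure IsSpectralDensity {Ω : Type*} [MeasurableSpace Ω] {P : Measure Ω} {d : ℕ}
    (X : ℤ → L2Vec P d) (f : ℝ → Matrix (Fin d) (Fin d) ℂ) : Prop where
  integrable : ∀ a b, IntegrableOn (fun w => f w a b) freq
  posSemidef : ∀ᵐ w ∂(volume.restrict freq), (f w).PosSemidef
  cov_eq : ∀ (t h : ℤ) (a b : Fin d), crossCov (X (t + h)) (X t) a b =
    ∫ w in freq, Complex.exp (Complex.I * (h : ℂ) * (w : ℂ)) * f w a b

/-- A stationary time series of constant rank `r`: it has a spectral density, whose rank is `r`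
at almost every frequency. -/
def HasConstantRank {Ω : Type*} [MeasurableSpace Ω] {P : Measure Ω} {d : ℕ}
    (X : ℤ → L2Vec P d) (r : ℕ) : Prop :=
  IsStationary X ∧ ∃ f, IsSpectralDensity X f ∧ ∀ᵐ w ∂(volume.restrict freq), (f w).rank = r

/-- The random vector `A V` for a constant matrix `A`. -/
noncomputable def matAct {Ω : Type*} [MeasurableSpace Ω] {P : Measure Ω} {d : ℕ}
    (A : Matrix (Fin d) (Fin d) ℂ) (V : L2Vec P d) : L2Vec P d :=
  (Matrix.toEuclideanCLM (n := Fin d) (𝕜 := ℂ) A).compLp V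

/-- The integral `∫ S dZ = ∑_A A Z(S = A)` of a simple matrix valued function with respect to an
`L²_d`-valued measure. -/
noncomputable def simpleIntegral {Ω : Type*} [MeasurableSpace Ω] {P : Measure Ω} {d : ℕ}
    (Z : VectorMeasure ℝ (L2Vec P d)) (S : SimpleFunc ℝ (Matrix (Fin d) (Fin d) ℂ)) :
    L2Vec P d :=
  ∑ A ∈ S.range, matAct A (Z (S ⁻¹' {A}))

/-- The squared norm `tr ∫ G f G^* dω` on the space `L²(f)`. -/
noncomputable def specNormSq {d : ℕ} (f G : ℝ → Matrix (Fin d) (Fin d) ℂ) : ℝ≥0∞ :=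
  ∫⁻ w in freq, ENNReal.ofReal (Matrix.trace (G w * f w * (G w)ᴴ)).re

/-- `V = ∫ G dZ`, the stochastic integral of a measurable matrix function `G`: the limit in mean
square of the integrals of simple functions that converge to `G` in `L²(f)`. -/
def HasSpectralIntegral {Ω : Type*} [MeasurableSpace Ω] {P : Measure Ω} {d : ℕ}
    (f : ℝ → Matrix (Fin d) (Fin d) ℂ) (Z : VectorMeasure ℝ (L2Vec P d))
    (G : ℝ → Matrix (Fin d) (Fin d) ℂ) (V : L2Vec P d) : Prop :=
  (∀ a b, AEMeasurable (fun w => G w a b) (volume.restrict freq)) ∧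
  ∃ S : ℕ → SimpleFunc ℝ (Matrix (Fin d) (Fin d) ℂ),
    Tendsto (fun n => specNormSq f (fun w => G w - S n w)) atTop (𝓝 0) ∧
    Tendsto (fun n => simpleIntegral Z (S n)) atTop (𝓝 V)

/-- `Y_t = ∫ e^{itω} T(ω) dZ_ω` for all `t`: the process `Y` is obtained by the linear filter
with transfer function `T`. -/
def IsFiltered {Ω : Type*} [MeasurableSpace Ω] {P : Measure Ω} {d : ℕ}
    (f : ℝ → Matrix (Fin d) (Fin d) ℂ) (Z : VectorMeasure ℝ (L2Vec P d))
    (T : ℝ → Matrix (Fin d) (Fin d) ℂ) (Y : ℤ → L2Vec P d) : Prop :=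
  ∀ t : ℤ, HasSpectralIntegral f Z
    (fun w => Complex.exp (Complex.I * (t : ℂ) * (w : ℂ)) • T w) (Y t)

/-- `Z` is the random spectral measure in Cramér's representation `X_t = ∫ e^{itω} dZ_ω`
of the series `X` with spectral density `f`. -/
structure IsCramerMeasure {Ω : Type*} [MeasurableSpace Ω] {P : Measure Ω} {d : ℕ}
    (X : ℤ → L2Vec P d) (f : ℝ → Matrix (Fin d) (Fin d) ℂ)
    (Z : VectorMeasure ℝ (L2Vec P d)) : Prop where
  cov_eq : ∀ A B : Set ℝ, MeasurableSet A → MeasurableSet B → ∀ a b : Fin d,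
    crossCov (Z A) (Z B) a b = ∫ w in A ∩ B ∩ freq, f w a b
  represents : IsFiltered f Z (fun _ => 1) X

/-- A measurable spectral decomposition `f = U diag(λ_1, …, λ_r) U^*` a.e., where
`λ_1 ≥ ⋯ ≥ λ_r > 0 = λ_{r+1} = ⋯ = λ_d` are the eigenvalues (numbered from `1`) and the columns of
`U` are orthonormal. -/
structure IsSpectralDecomposition {d : ℕ} (r : ℕ) (f : ℝ → Matrix (Fin d) (Fin d) ℂ)
    (lam : ℕ → ℝ → ℝ) (U : ℝ → Matrix (Fin d) (Fin r) ℂ) : Prop where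
  measurable : ∀ a j, AEMeasurable (fun w => U w a j) (volume.restrict freq)
  antitone : ∀ᵐ w ∂(volume.restrict freq), ∀ i j, 1 ≤ i → i ≤ j → j ≤ r → lam j w ≤ lam i w
  pos : ∀ᵐ w ∂(volume.restrict freq), ∀ j, 1 ≤ j → j ≤ r → 0 < lam j w
  eq_zero : ∀ᵐ w ∂(volume.restrict freq), ∀ j, r < j → j ≤ d → lam j w = 0
  orthonormal : ∀ᵐ w ∂(volume.restrict freq), (U w)ᴴ * U w = 1
  decomp : ∀ᵐ w ∂(volume.restrict freq),
    f w = U w * Matrix.diagonal (fun i : Fin r => (lam (i.val + 1) w : ℂ)) * (U w)ᴴ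

/-- The first `k` columns of a matrix with `r` columns. -/
def firstCols {d r k : ℕ} (hk : k ≤ r) (U : Matrix (Fin d) (Fin r) ℂ) :
    Matrix (Fin d) (Fin k) ℂ :=
  U.submatrix id (Fin.castLE hk)

/-- The orthogonal projection `U_k U_k^*`, where `U_k` consists of the first `k` columns. -/
def projFilter {d r k : ℕ} (hk : k ≤ r) (U : ℝ → Matrix (Fin d) (Fin r) ℂ) :
    ℝ → Matrix (Fin d) (Fin d) ℂ :=
  fun w => firstCols hk (U w) * (firstCols hk (U w))ᴴ

end RankReduction

/-!
Factor the density as `f = M M^*` with `M = U diag(√λ_1, …, √λ_r)`. A random measure `Z` with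
covariance `∫ f` is the same thing as an isometry `J` from `L²` of the row vector functions with
`r` entries into `L²(P)`: component `b` of `Z(A)` is the image of `1_A` times row `b` of `M`, and
the rows of `G M` are sent to the components of `∫ G dZ`. Since `M` is injective, the rows of
`e^{itω} M(ω)` span a dense subspace, so the covariances of `X` determine `J`, which gives Cramér's
representation and its uniqueness.

The error of a filter `T` has density `(1 - T) f (1 - T)^*`, whose trace is the squared Frobenius
distance from `M` to `T M`. As `T f T^*` and `T M` have the same rank, the minimization over filters
of rank at most `k` is done frequency by frequency, by the Eckart–Young theorem.
-/

namespace RankReduction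

section Gram

variable {𝕜 ι H K : Type*} [RCLike 𝕜] [NormedAddCommGroup H] [InnerProductSpace 𝕜 H]
  [NormedAddCommGroup K] [InnerProductSpace 𝕜 K] {φ : ι → H}

theorem norm_linearCombination_eq_of_inner_eq {ψ : ι → K}
    (hφψ : ∀ i j, inner 𝕜 (φ i) (φ j) = inner 𝕜 (ψ i) (ψ j)) (c : ι →₀ 𝕜) :
    ‖Finsupp.linearCombination 𝕜 ψ c‖ = ‖Finsupp.linearCombination 𝕜 φ c‖ := by
  simp only [norm_eq_sqrt_re_inner (𝕜 := 𝕜), Finsupp.linearCombination_apply, Finsupp.sum_inner,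
    Finsupp.inner_sum, inner_smul_left, inner_smul_right, hφψ]

theorem exists_linearIsometry_of_inner_eq [CompleteSpace K] {ψ : ι → K}
    (hφψ : ∀ i j, inner 𝕜 (φ i) (φ j) = inner 𝕜 (ψ i) (ψ j))
    (hφ : (Submodule.span 𝕜 (Set.range φ)).topologicalClosure = ⊤) :
    ∃ J : H →ₗᵢ[𝕜] K, ∀ i, J (φ i) = ψ i := by
  set a := Finsupp.linearCombination 𝕜 φ
  set b := Finsupp.linearCombination 𝕜 ψ
  have hnorm : ∀ c, ‖b c‖ = ‖a c‖ := norm_linearCombination_eq_of_inner_eq hφψ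
  have hdense : DenseRange a := by
    rwa [← Finsupp.range_linearCombination, ← Submodule.dense_iff_topologicalClosure_eq_top,
      LinearMap.coe_range] at hφ
  have hext : ∀ c, b.extendOfNorm a (a c) = b c :=
    LinearMap.extendOfNorm_eq hdense ⟨1, fun c => by simp only [hnorm, one_mul, le_refl]⟩
  refine ⟨⟨(b.extendOfNorm a).toLinearMap, fun x => ?_⟩, fun i => ?_⟩
  · refine hdense.induction (P := fun x => ‖b.extendOfNorm a x‖ = ‖x‖) ?_
      (isClosed_eq (by fun_prop) (by fun_prop)) x
    rintro _ ⟨c, rfl⟩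
    rw [hext, hnorm]
  · simpa [a, b] using hext (Finsupp.single i 1)

theorem linearIsometry_eq_of_eqOn_total
    (hφ : (Submodule.span 𝕜 (Set.range φ)).topologicalClosure = ⊤)
    {J J' : H →ₗᵢ[𝕜] K} (h : ∀ i, J (φ i) = J' (φ i)) : J = J' := by
  rw [← LinearIsometry.toContinuousLinearMap_inj]
  refine ContinuousLinearMap.ext_on (s := Set.range φ) ?_ ?_
  · rwa [Submodule.dense_iff_topologicalClosure_eq_top]
  · rintro _ ⟨i, rfl⟩
    exact h i

end Gram

section Fourier

variable {T : ℝ} [Fact (0 < T)] {a : ℝ} {h : ℝ → ℂ}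

theorem integral_mul_eq_zero_of_integral_fourier_mul_eq_zero {s : Set ℝ} (hh : IntegrableOn h s)
    (hz : ∀ n : ℤ, ∫ w in s, fourier n (w : AddCircle T) * h w = 0) (F : C(AddCircle T, ℂ)) :
    ∫ w in s, F (w : AddCircle T) * h w = 0 := by
  have hint : ∀ F : C(AddCircle T, ℂ), IntegrableOn (fun w : ℝ => F (w : AddCircle T) * h w) s :=
    fun F => Integrable.bdd_mul hh
      (F.continuous.comp (AddCircle.continuous_mk' T)).aestronglyMeasurable
      (ae_of_all _ fun w => F.norm_coe_le_norm _)
  let Λ : C(AddCircle T, ℂ) →ₗ[ℂ] ℂ :=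
    { toFun := fun F => ∫ w in s, F (w : AddCircle T) * h w
      map_add' := fun F G => by
        simp only [ContinuousMap.add_apply, add_mul]
        exact integral_add (hint F) (hint G)
      map_smul' := fun c F => by
        simp only [ContinuousMap.smul_apply, smul_eq_mul, mul_assoc, RingHom.id_apply]
        exact integral_const_mul _ _ }
  have hbound : ∀ F, ‖Λ F‖ ≤ (∫ w in s, ‖h w‖) * ‖F‖ := fun F =>
    calc ‖Λ F‖ ≤ ∫ w in s, ‖F (w : AddCircle T) * h w‖ := norm_integral_le_integral_norm _
      _ ≤ ∫ w in s, ‖h w‖ * ‖F‖ := by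
        refine integral_mono (hint F).norm (hh.norm.mul_const _) fun w => ?_
        simp only [norm_mul, mul_comm ‖h w‖]
        gcongr
        exact F.norm_coe_le_norm _
      _ = (∫ w in s, ‖h w‖) * ‖F‖ := integral_mul_const _ _
  have hΛ : Λ.mkContinuous _ hbound = 0 := by
    refine ContinuousLinearMap.ext_on (s := Set.range (@fourier T)) ?_ ?_
    · rw [Submodule.dense_iff_topologicalClosure_eq_top, span_fourier_closure_eq_top]
    · rintro _ ⟨n, rfl⟩
      exact hz n
  exact DFunLike.congr_fun hΛ F

theorem ae_eq_zero_of_integral_fourier_mul_eq_zero (hh : IntegrableOn h (Set.Icc a (a + T)))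
    (hz : ∀ n : ℤ, ∫ w in Set.Icc a (a + T), fourier n (w : AddCircle T) * h w = 0) :
    ∀ᵐ w ∂volume.restrict (Set.Icc a (a + T)), h w = 0 := by
  rw [← restrict_Ioo_eq_restrict_Icc, ae_restrict_iff' measurableSet_Ioo]
  refine isOpen_Ioo.ae_eq_zero_of_integral_contDiff_smul_eq_zero
    (hh.mono_set Set.Ioo_subset_Icc_self).locallyIntegrableOn fun g hg _ hsupp => ?_
  have hg0 : ∀ w, w ∉ Set.Ioo a (a + T) → g w = 0 := fun w hw =>
    image_eq_zero_of_notMem_tsupport fun hw' => hw (hsupp hw')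
  have hcont : Continuous (AddCircle.liftIco T a fun w => (g w : ℂ)) := by
    refine AddCircle.liftIco_continuous ?_
      (Complex.continuous_ofReal.comp hg.continuous).continuousOn
    rw [hg0 a fun hw => hw.1.false, hg0 (a + T) fun hw => hw.2.false]
  calc ∫ w, g w • h w = ∫ w in Set.Icc a (a + T), g w • h w := by
        refine (setIntegral_eq_integral_of_forall_compl_eq_zero fun w hw => ?_).symm
        rw [hg0 w fun hw' => hw (Set.Ioo_subset_Icc_self hw'), zero_smul]
    _ = ∫ w in Set.Icc a (a + T), AddCircle.liftIco T a (fun w => (g w : ℂ)) w * h w := by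
        rw [integral_Icc_eq_integral_Ico, integral_Icc_eq_integral_Ico]
        refine setIntegral_congr_fun measurableSet_Ico fun w hw => ?_
        simp only [AddCircle.liftIco_coe_apply hw, Complex.real_smul]
    _ = 0 := integral_mul_eq_zero_of_integral_fourier_mul_eq_zero hh hz ⟨_, hcont⟩

theorem ae_eq_zero_of_integral_exp_mul_eq_zero (hh : IntegrableOn h freq)
    (hz : ∀ t : ℤ, ∫ w in freq, Complex.exp (Complex.I * (t : ℂ) * (w : ℂ)) * h w = 0) :
    ∀ᵐ w ∂volume.restrict freq, h w = 0 := by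
  have : Fact (0 < 2 * Real.pi) := ⟨Real.two_pi_pos⟩
  have hfreq : freq = Set.Icc (-Real.pi) (-Real.pi + 2 * Real.pi) := by
    rw [freq]; congr 1; ring
  rw [hfreq] at hh hz ⊢
  have hπ : (Real.pi : ℂ) ≠ 0 := mod_cast Real.pi_ne_zero
  refine ae_eq_zero_of_integral_fourier_mul_eq_zero hh fun n => Eq.trans ?_ (hz n)
  refine integral_congr_ae (ae_of_all _ fun w => ?_)
  simp only [fourier_coe_apply, Complex.ofReal_mul, Complex.ofReal_ofNat]
  congr 2
  field_simp

end Fourier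

section LowRank

theorem sum_mul_le_sum_of_threshold {ι : Type*} [Fintype ι] {l p : ι → ℝ} {s : Finset ι} {c : ℝ}
    (hc : 0 ≤ c) (hs : ∀ i ∈ s, c ≤ l i) (hs' : ∀ i ∉ s, l i ≤ c) (hp0 : ∀ i, 0 ≤ p i)
    (hp1 : ∀ i, p i ≤ 1) (hp : ∑ i, p i ≤ s.card) : ∑ i, l i * p i ≤ ∑ i ∈ s, l i := by
  classical
  have hterm : ∀ i, (l i - c) * p i ≤ if i ∈ s then l i - c else 0 := fun i => by
    split_ifs with hi
    · nlinarith [hs i hi, hp1 i]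
    · nlinarith [hs' i hi, hp0 i]
  have hsum : ∑ i, (l i - c) * p i ≤ ∑ i ∈ s, (l i - c) :=
    (Finset.sum_le_sum fun i _ => hterm i).trans_eq (by simp [Finset.sum_ite_mem])
  simp only [sub_mul, Finset.sum_sub_distrib, ← Finset.mul_sum, Finset.sum_const,
    nsmul_eq_mul] at hsum
  nlinarith

variable {𝕜 E ι : Type*} [RCLike 𝕜] [NormedAddCommGroup E] [InnerProductSpace 𝕜 E]

theorem sum_norm_sq_starProjection_le_finrank [Fintype ι] {u : ι → E} (hu : Orthonormal 𝕜 u)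
    (W : Submodule 𝕜 E) [FiniteDimensional 𝕜 W] :
    ∑ i, ‖W.starProjection (u i)‖ ^ 2 ≤ Module.finrank 𝕜 W := by
  set b := stdOrthonormalBasis 𝕜 W
  have hexpand : ∀ i, ‖W.starProjection (u i)‖ ^ 2 = ∑ j, ‖inner 𝕜 (u i) (b j : E)‖ ^ 2 := by
    intro i
    rw [Submodule.starProjection_apply, ← Submodule.coe_norm,
      ← b.sum_sq_norm_inner_right (W.orthogonalProjectionOnto (u i))]
    refine Finset.sum_congr rfl fun j _ => ?_
    rw [Submodule.inner_orthogonalProjectionOnto_eq_of_mem_left, norm_inner_symm]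
  calc ∑ i, ‖W.starProjection (u i)‖ ^ 2 = ∑ j, ∑ i, ‖inner 𝕜 (u i) (b j : E)‖ ^ 2 := by
        simp only [hexpand, Finset.sum_comm (γ := ι)]
    _ ≤ ∑ j, ‖(b j : E)‖ ^ 2 := Finset.sum_le_sum fun j _ => hu.sum_inner_products_le _
    _ = Module.finrank 𝕜 W := by simp [← Submodule.coe_norm]

theorem norm_sq_sub_norm_sq_starProjection_le (W : Submodule 𝕜 E) [W.HasOrthogonalProjection]
    (x : E) {w : E} (hw : w ∈ W) : ‖x‖ ^ 2 - ‖W.starProjection x‖ ^ 2 ≤ ‖x - w‖ ^ 2 := by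
  have hx := W.norm_sq_eq_add_norm_sq_starProjection x
  have hxw := W.norm_sq_eq_add_norm_sq_starProjection (x - w)
  rw [map_sub Wᗮ.starProjection, (Submodule.starProjection_apply_eq_zero_iff _).2
    (W.le_orthogonal_orthogonal hw), sub_zero] at hxw
  nlinarith [sq_nonneg ‖W.starProjection (x - w)‖]

/- The Eckart–Young bound. The weights `p i`, the squared norms of the projections of the `u i` to
the span of the `w i`, lie in `[0, 1]` and have sum at most `s.card`, so that `∑ σ i ^ 2 * p i` is
largest when they sit on `s`. -/
theorem sum_compl_sq_le_sum_norm_sub_sq [Fintype ι] [DecidableEq ι] {u w : ι → E}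
    (hu : Orthonormal 𝕜 u) {σ : ι → ℝ} {s : Finset ι} {c : ℝ} (hs : ∀ i ∈ s, c ≤ σ i ^ 2)
    (hc : 0 ≤ c) (hs' : ∀ i ∉ s, σ i ^ 2 ≤ c)
    (hw : Module.finrank 𝕜 (Submodule.span 𝕜 (Set.range w)) ≤ s.card) :
    ∑ i ∈ sᶜ, σ i ^ 2 ≤ ∑ i, ‖(σ i : 𝕜) • u i - w i‖ ^ 2 := by
  set W := Submodule.span 𝕜 (Set.range w)
  have : FiniteDimensional 𝕜 W := FiniteDimensional.span_of_finite 𝕜 (Set.finite_range w)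
  set p : ι → ℝ := fun i => ‖W.starProjection (u i)‖ ^ 2
  have hp1 : ∀ i, p i ≤ 1 := fun i =>
    pow_le_one₀ (norm_nonneg _) ((W.norm_starProjection_apply_le _).trans_eq (hu.1 i))
  have hp : ∑ i, p i ≤ s.card :=
    (sum_norm_sq_starProjection_le_finrank hu W).trans (mod_cast hw)
  have hmass := sum_mul_le_sum_of_threshold hc hs hs' (fun i => sq_nonneg _) hp1 hp
  have hterm : ∀ i, σ i ^ 2 - σ i ^ 2 * p i ≤ ‖(σ i : 𝕜) • u i - w i‖ ^ 2 := by
    intro i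
    have hdist := norm_sq_sub_norm_sq_starProjection_le W ((σ i : 𝕜) • u i)
      (Submodule.subset_span (Set.mem_range_self i) : w i ∈ W)
    rwa [map_smul, norm_smul, norm_smul, hu.1 i, mul_pow, mul_pow, RCLike.norm_ofReal, sq_abs,
      one_pow, mul_one] at hdist
  calc ∑ i ∈ sᶜ, σ i ^ 2 = ∑ i, σ i ^ 2 - ∑ i ∈ s, σ i ^ 2 := by
        rw [← Finset.sum_add_sum_compl s]; ring
    _ ≤ ∑ i, (σ i ^ 2 - σ i ^ 2 * p i) := by rw [Finset.sum_sub_distrib]; linarith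
    _ ≤ ∑ i, ‖(σ i : 𝕜) • u i - w i‖ ^ 2 := Finset.sum_le_sum fun i _ => hterm i

end LowRank

section Matrix

/-- The factor `M = U diag(√l)` of `U diag(l) Uᴴ = M Mᴴ`. -/
noncomputable def sqrtFactor {m n : Type*} [Fintype n] [DecidableEq n] (U : Matrix m n ℂ)
    (l : n → ℝ) : Matrix m n ℂ :=
  U * Matrix.diagonal fun j => (√(l j) : ℂ)

theorem sqrtFactor_mul_conjTranspose {m n : Type*} [Fintype n] [DecidableEq n]
    (U : Matrix m n ℂ) {l : n → ℝ} (hl : ∀ j, 0 ≤ l j) :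
    sqrtFactor U l * (sqrtFactor U l)ᴴ = U * Matrix.diagonal (fun j => (l j : ℂ)) * Uᴴ := by
  have hsq : (fun j => (√(l j) : ℂ) * star (√(l j) : ℂ)) = fun j => (l j : ℂ) := by
    funext j
    rw [Complex.star_def, Complex.conj_ofReal, ← Complex.ofReal_mul, Real.mul_self_sqrt (hl j)]
  rw [sqrtFactor, Matrix.conjTranspose_mul, Matrix.diagonal_conjTranspose, Matrix.mul_assoc,
    ← Matrix.mul_assoc (Matrix.diagonal _), Matrix.diagonal_mul_diagonal, ← Matrix.mul_assoc,
    ← hsq]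
  rfl

theorem finrank_span_range_toLp_col {m n : Type*} [Fintype n] (A : Matrix m n ℂ) :
    Module.finrank ℂ (Submodule.span ℂ (Set.range fun j =>
      (WithLp.toLp 2 (A.col j) : EuclideanSpace ℂ m))) = A.rank := by
  rw [Matrix.rank_eq_finrank_span_cols,
    ← LinearEquiv.finrank_map_eq (WithLp.linearEquiv 2 ℂ (m → ℂ)).symm, Submodule.map_span,
    ← Set.range_comp]
  rfl

variable {m n p : Type*} [Fintype m]

theorem re_trace_mul_conjTranspose_self [Fintype n] (A : Matrix m n ℂ) :
    (A * Aᴴ).trace.re = ∑ a, ∑ j, ‖A a j‖ ^ 2 := by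
  simp only [Matrix.trace, Matrix.diag, Matrix.mul_apply, Matrix.conjTranspose_apply,
    Complex.star_def, Complex.mul_conj, Complex.re_sum, Complex.ofReal_re,
    Complex.normSq_eq_norm_sq]

theorem rank_mul_mul_conjTranspose_self [Fintype n] [Fintype p] (M : Matrix m n ℂ)
    (A : Matrix p m ℂ) : (A * (M * Mᴴ) * Aᴴ).rank = (A * M).rank := by
  rw [← Matrix.rank_self_mul_conjTranspose (A * M), Matrix.conjTranspose_mul]
  simp only [Matrix.mul_assoc]

theorem proj_mul_mul_proj [Fintype n] (U : Matrix m n ℂ) (A : Matrix m m ℂ) :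
    U * Uᴴ * A * (U * Uᴴ)ᴴ = U * (Uᴴ * A * U) * Uᴴ := by
  simp only [Matrix.conjTranspose_mul, Matrix.conjTranspose_conjTranspose, Matrix.mul_assoc]

variable [DecidableEq n] {U : Matrix m n ℂ}

theorem orthonormal_toLp_col (hU : Uᴴ * U = 1) :
    Orthonormal ℂ fun j => (WithLp.toLp 2 (U.col j) : EuclideanSpace ℂ m) := by
  refine orthonormal_iff_ite.2 fun i j => ?_
  rw [← Matrix.one_apply, ← hU, Matrix.mul_apply]
  simp [PiLp.inner_apply, mul_comm]

variable [Fintype n]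

theorem conjTranspose_mul_conj_mul (hU : Uᴴ * U = 1) (A : Matrix n n ℂ) :
    Uᴴ * (U * A * Uᴴ) * U = A := by
  rw [← Matrix.mul_assoc, ← Matrix.mul_assoc, hU, Matrix.one_mul, Matrix.mul_assoc, hU,
    Matrix.mul_one]

theorem rank_conj_of_conjTranspose_mul_self (hU : Uᴴ * U = 1) (A : Matrix n n ℂ) :
    (U * A * Uᴴ).rank = A.rank := by
  refine le_antisymm ((Matrix.rank_mul_le_left _ _).trans (Matrix.rank_mul_le_right _ _)) ?_
  calc A.rank = (Uᴴ * (U * A * Uᴴ) * U).rank := by rw [conjTranspose_mul_conj_mul hU]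
    _ ≤ (U * A * Uᴴ).rank := (Matrix.rank_mul_le_left _ _).trans (Matrix.rank_mul_le_right _ _)

theorem trace_conj_of_conjTranspose_mul_self (hU : Uᴴ * U = 1) (A : Matrix n n ℂ) :
    (U * A * Uᴴ).trace = A.trace := by
  rw [Matrix.mul_assoc, Matrix.trace_mul_comm, Matrix.mul_assoc, hU, Matrix.mul_one]

theorem trace_one_sub_proj_mul_mul_one_sub_proj [DecidableEq m] (hU : Uᴴ * U = 1)
    (A : Matrix m m ℂ) :
    ((1 - U * Uᴴ) * A * (1 - U * Uᴴ)ᴴ).trace = A.trace - (Uᴴ * A * U).trace := by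
  have hcompress : (U * Uᴴ * A * (U * Uᴴ)ᴴ).trace = (Uᴴ * A * U).trace := by
    rw [proj_mul_mul_proj, trace_conj_of_conjTranspose_mul_self hU]
  have hcross : (A * (U * Uᴴ)).trace = (Uᴴ * A * U).trace := by
    rw [← Matrix.mul_assoc, Matrix.trace_mul_comm, Matrix.mul_assoc]
  have hcross' : (U * Uᴴ * A).trace = (Uᴴ * A * U).trace := by
    rw [Matrix.trace_mul_comm, hcross]
  have hherm : (U * Uᴴ)ᴴ = U * Uᴴ := Matrix.isHermitian_mul_conjTranspose_self U
  rw [hherm] at hcompress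
  simp only [Matrix.conjTranspose_sub, Matrix.conjTranspose_one, hherm, Matrix.sub_mul,
    Matrix.mul_sub, Matrix.one_mul, Matrix.mul_one, Matrix.trace_sub, hcross, hcross', hcompress]
  ring

theorem injective_mulVec_sqrtFactor (hU : Uᴴ * U = 1) {l : n → ℝ} (hl : ∀ j, 0 < l j) :
    Function.Injective (sqrtFactor U l).mulVec := by
  have hinv : Matrix.diagonal (fun j => (√(l j) : ℂ)⁻¹) * Uᴴ * sqrtFactor U l = 1 := by
    have hne : ∀ j, (√(l j) : ℂ) ≠ 0 := fun j => mod_cast (Real.sqrt_pos.2 (hl j)).ne'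
    rw [sqrtFactor, Matrix.mul_assoc, ← Matrix.mul_assoc Uᴴ, hU, Matrix.one_mul,
      Matrix.diagonal_mul_diagonal, ← Matrix.diagonal_one]
    simp only [inv_mul_cancel₀ (hne _)]
  refine Function.LeftInverse.injective
    (g := (Matrix.diagonal (fun j => (√(l j) : ℂ)⁻¹) * Uᴴ).mulVec) fun v => ?_
  rw [Matrix.mulVec_mulVec, hinv, Matrix.one_mulVec]

end Matrix

section Truncation

variable {d r k : ℕ} {U : Matrix (Fin d) (Fin r) ℂ} {l : Fin r → ℝ}

theorem conjTranspose_firstCols_mul_firstCols (hk : k ≤ r) (hU : Uᴴ * U = 1) :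
    (firstCols hk U)ᴴ * firstCols hk U = 1 := by
  have hsub : (firstCols hk U)ᴴ * firstCols hk U =
      (Uᴴ * U).submatrix (Fin.castLE hk) (Fin.castLE hk) := rfl
  rw [hsub, hU, Matrix.submatrix_one _ (Fin.castLE_injective hk)]

theorem conjTranspose_firstCols_mul_mul_firstCols (hk : k ≤ r) (hU : Uᴴ * U = 1) :
    (firstCols hk U)ᴴ * (U * Matrix.diagonal (fun j => (l j : ℂ)) * Uᴴ) * firstCols hk U =
      Matrix.diagonal fun j => (l (Fin.castLE hk j) : ℂ) := by
  have hsub (A : Matrix (Fin d) (Fin d) ℂ) : (firstCols hk U)ᴴ * A * firstCols hk U =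
      (Uᴴ * A * U).submatrix (Fin.castLE hk) (Fin.castLE hk) := rfl
  rw [hsub, conjTranspose_mul_conj_mul hU, Matrix.submatrix_diagonal _ _ (Fin.castLE_injective hk)]
  rfl

theorem sum_castLE_add_sum_tail (hk : k ≤ r) (l : Fin r → ℝ) :
    ∑ j, l (Fin.castLE hk j) + ∑ j : Fin r with k ≤ j.val, l j = ∑ j, l j := by
  obtain ⟨n, rfl⟩ := Nat.exists_eq_add_of_le hk
  rw [← Finset.sum_filter_add_sum_filter_not Finset.univ (fun j : Fin (k + n) => k ≤ j.val) l,
    add_comm]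
  congr 1
  have hcast : ∀ j, Fin.castLE hk j = Fin.castAdd n j := fun _ => rfl
  simp [Finset.sum_filter, Fin.sum_univ_add, hcast]

theorem trace_one_sub_proj_firstCols (hk : k ≤ r) (hU : Uᴴ * U = 1) :
    ((1 - firstCols hk U * (firstCols hk U)ᴴ) * (U * Matrix.diagonal (fun j => (l j : ℂ)) * Uᴴ) *
      (1 - firstCols hk U * (firstCols hk U)ᴴ)ᴴ).trace =
      ((∑ j : Fin r with k ≤ j.val, l j : ℝ) : ℂ) := by
  rw [trace_one_sub_proj_mul_mul_one_sub_proj (conjTranspose_firstCols_mul_firstCols hk hU),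
    conjTranspose_firstCols_mul_mul_firstCols hk hU, trace_conj_of_conjTranspose_mul_self hU,
    Matrix.trace_diagonal, Matrix.trace_diagonal, sub_eq_iff_eq_add, ← Complex.ofReal_sum,
    ← Complex.ofReal_sum, ← Complex.ofReal_add, add_comm, sum_castLE_add_sum_tail]

theorem exists_threshold_of_antitone (k : ℕ) (hl0 : ∀ j, 0 ≤ l j) (hl : Antitone l) :
    ∃ c, 0 ≤ c ∧ (∀ j : Fin r, j.val < k → c ≤ l j) ∧ ∀ j : Fin r, k ≤ j.val → l j ≤ c := by
  by_cases hkr : k < r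
  · exact ⟨l ⟨k, hkr⟩, hl0 _, fun j hj => hl hj.le, fun j hj => hl hj⟩
  · exact ⟨0, le_rfl, fun j _ => hl0 j, fun j hj => absurd (hj.trans_lt j.isLt) hkr⟩

theorem sum_tail_le_sum_norm_sqrtFactor_sub_sq (hk : k ≤ r) (hU : Uᴴ * U = 1) (hl0 : ∀ j, 0 ≤ l j)
    (hl : Antitone l) {B : Matrix (Fin d) (Fin r) ℂ} (hB : B.rank ≤ k) :
    ∑ j : Fin r with k ≤ j.val, l j ≤ ∑ a, ∑ j, ‖(sqrtFactor U l - B) a j‖ ^ 2 := by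
  obtain ⟨c, hc, hhead, htail⟩ := exists_threshold_of_antitone k hl0 hl
  set s : Finset (Fin r) := {j | j.val < k}
  have hcard : s.card = k := by simp only [s, Fin.card_filter_val_lt, min_eq_right hk]
  have hcompl : sᶜ = Finset.univ.filter fun j : Fin r => k ≤ j.val := by ext; simp [s]
  have hsq : ∀ j, √(l j) ^ 2 = l j := fun j => Real.sq_sqrt (hl0 j)
  have hEY := sum_compl_sq_le_sum_norm_sub_sq (𝕜 := ℂ) (σ := fun j => √(l j)) (s := s) (c := c)
    (orthonormal_toLp_col hU) (by simpa [s, hsq] using hhead) hc (by simpa [s, hsq] using htail)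
    ((finrank_span_range_toLp_col B).trans_le (hB.trans_eq hcard.symm))
  rw [hcompl] at hEY
  simp only [hsq] at hEY
  refine hEY.trans_eq ?_
  rw [Finset.sum_comm]
  refine Finset.sum_congr rfl fun j _ => ?_
  rw [EuclideanSpace.norm_sq_eq]
  simp [sqrtFactor, Matrix.mul_diagonal, mul_comm]

theorem sum_tail_le_re_trace_of_rank_le (hk : k ≤ r) (hU : Uᴴ * U = 1) (hl0 : ∀ j, 0 ≤ l j)
    (hl : Antitone l) {F T : Matrix (Fin d) (Fin d) ℂ}
    (hF : F = U * Matrix.diagonal (fun j => (l j : ℂ)) * Uᴴ) (hT : (T * F * Tᴴ).rank ≤ k) :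
    ∑ j : Fin r with k ≤ j.val, l j ≤ ((1 - T) * F * (1 - T)ᴴ).trace.re := by
  rw [← sqrtFactor_mul_conjTranspose U hl0] at hF
  set M := sqrtFactor U l
  have hrank : (T * M).rank ≤ k := by rwa [← rank_mul_mul_conjTranspose_self, ← hF]
  have hfrob : (1 - T) * F * (1 - T)ᴴ = (M - T * M) * (M - T * M)ᴴ := by
    have hsub : M - T * M = (1 - T) * M := by rw [Matrix.sub_mul, Matrix.one_mul]
    simp only [hF, hsub, Matrix.conjTranspose_mul, Matrix.mul_assoc]
  rw [hfrob, re_trace_mul_conjTranspose_self]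
  exact sum_tail_le_sum_norm_sqrtFactor_sub_sq hk hU hl0 hl hrank

end Truncation

section Components

variable {Ω : Type*} [MeasurableSpace Ω] {P : Measure Ω} {d : ℕ}

/-- The `a`-th component of a square integrable random vector. -/
noncomputable def component (a : Fin d) : L2Vec P d →L[ℂ] Lp ℂ 2 P :=
  (EuclideanSpace.proj a : EuclideanSpace ℂ (Fin d) →L[ℂ] ℂ).compLpL 2 P

theorem coeFn_component (a : Fin d) (V : L2Vec P d) : component a V =ᵐ[P] fun x => V x a :=
  ContinuousLinearMap.coeFn_compLpL _ V

theorem ext_component {V W : L2Vec P d} (h : ∀ a, component a V = component a W) : V = W := by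
  refine Lp.ext ?_
  filter_upwards [ae_all_iff.2 fun a => coeFn_component a V,
    ae_all_iff.2 fun a => coeFn_component a W] with x hV hW
  ext a
  rw [← hV a, ← hW a, h a]

/-- The square integrable random vector with given components. -/
noncomputable def ofComponents (v : Fin d → Lp ℂ 2 P) : L2Vec P d :=
  (MemLp.of_eval_piLp (f := fun x => WithLp.toLp 2 fun a => v a x) fun a => Lp.memLp (v a)).toLp _

@[simp]
theorem component_ofComponents (v : Fin d → Lp ℂ 2 P) (a : Fin d) :
    component a (ofComponents v) = v a := by
  refine Lp.ext ((coeFn_component a _).trans ?_)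
  filter_upwards [MemLp.coeFn_toLp (MemLp.of_eval_piLp (q := 2)
    (f := fun x => WithLp.toLp 2 fun a => v a x) fun a => Lp.memLp (v a))] with x hx
  rw [ofComponents, hx]

theorem crossCov_apply (V W : L2Vec P d) (a b : Fin d) :
    crossCov V W a b = inner ℂ (component b W) (component a V) := by
  rw [L2.inner_def]
  refine integral_congr_ae ?_
  filter_upwards [coeFn_component a V, coeFn_component b W] with x hV hW
  rw [hV, hW, RCLike.inner_apply']
  exact mul_comm _ _

theorem trace_crossCov_self (V : L2Vec P d) : (crossCov V V).trace = (‖V‖ ^ 2 : ℝ) := by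
  simp only [Matrix.trace, Matrix.diag_apply, crossCov_apply, L2.inner_def]
  rw [← integral_finsetSum _ fun a _ => L2.integrable_inner _ _, Complex.ofReal_pow,
    ← Complex.coe_algebraMap, ← inner_self_eq_norm_sq_to_K (𝕜 := ℂ) V, L2.inner_def]
  refine integral_congr_ae ?_
  filter_upwards [ae_all_iff.2 fun a => coeFn_component a V] with x hx
  simp only [hx, PiLp.inner_apply]

theorem norm_sq_eq_sum_component (V : L2Vec P d) : ‖V‖ ^ 2 = ∑ a, ‖component a V‖ ^ 2 := by
  have h := trace_crossCov_self V
  simp only [Matrix.trace, Matrix.diag_apply, crossCov_apply, inner_self_eq_norm_sq_to_K,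
    Complex.coe_algebraMap] at h
  exact_mod_cast h.symm

theorem component_matAct (A : Matrix (Fin d) (Fin d) ℂ) (V : L2Vec P d) (a : Fin d) :
    component a (matAct A V) = ∑ b, A a b • component b V := by
  refine Lp.ext ?_
  filter_upwards [coeFn_component a (matAct A V),
    ContinuousLinearMap.coeFn_compLp (Matrix.toEuclideanCLM (n := Fin d) (𝕜 := ℂ) A) V,
    Lp.coeFn_fun_finsetSum Finset.univ (fun b => A a b • component b V),
    ae_all_iff.2 fun b => Lp.coeFn_smul (A a b) (component b V),
    ae_all_iff.2 fun b => coeFn_component b V] with x h₁ h₂ h₃ h₄ h₅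
  rw [h₁, h₃, matAct, h₂]
  simp [h₄, h₅, Matrix.mulVec, dotProduct]

theorem tendsto_iff_component {ι : Type*} {l : Filter ι} {v : ι → L2Vec P d} {V : L2Vec P d} :
    Tendsto v l (𝓝 V) ↔ ∀ a, Tendsto (fun n => component a (v n)) l (𝓝 (component a V)) := by
  refine ⟨fun h a => ((component a).continuous.tendsto V).comp h, fun h => ?_⟩
  have hsq : Tendsto (fun n => ‖v n - V‖ ^ 2) l (𝓝 0) := by
    simp only [norm_sq_eq_sum_component, map_sub]
    simpa using tendsto_finsetSum Finset.univ fun a _ =>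
      (tendsto_iff_norm_sub_tendsto_zero.1 (h a)).pow 2
  rw [tendsto_iff_norm_sub_tendsto_zero]
  simpa [Real.sqrt_sq (norm_nonneg _)] using hsq.sqrt

end Components

section Model

variable {α m n : Type*}

section RowMul

variable [Fintype m] {M : α → Matrix m n ℂ}

/-- The function `g M`, for a function `g` whose values are row vectors. -/
noncomputable def rowMul (M : α → Matrix m n ℂ) (g : α → m → ℂ) : α → EuclideanSpace ℂ n :=
  fun w => WithLp.toLp 2 (g w ᵥ* M w)

theorem rowMul_add (g g' : α → m → ℂ) : rowMul M (g + g') = rowMul M g + rowMul M g' := by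
  funext w
  simp [rowMul, Matrix.add_vecMul]

theorem rowMul_sub (g g' : α → m → ℂ) : rowMul M (g - g') = rowMul M g - rowMul M g' := by
  funext w
  simp [rowMul, Matrix.sub_vecMul]

theorem rowMul_smul (c : ℂ) (g : α → m → ℂ) : rowMul M (c • g) = c • rowMul M g := by
  funext w
  simp [rowMul, Matrix.smul_vecMul]

theorem inner_rowMul [Fintype n] (g g' : α → m → ℂ) (w : α) :
    inner ℂ (rowMul M g w) (rowMul M g' w) = g' w ⬝ᵥ (M w * (M w)ᴴ) *ᵥ star (g w) := by
  rw [EuclideanSpace.inner_eq_star_dotProduct]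
  simp only [rowMul]
  rw [Matrix.star_vecMul, Matrix.dotProduct_mulVec, Matrix.dotProduct_mulVec,
    ← Matrix.vecMul_vecMul]

end RowMul

variable [MeasurableSpace α] [Fintype n] {μ : Measure α} {f : α → Matrix m m ℂ}
  {M : α → Matrix m n ℂ}

/-- A square integrable factorization `f = M M^*` with injective `M`. It makes `g ↦ g M` an
isometry into `L²` of the row vector functions `g` with the seminorm `∫ g f g^*`, so that no
Hilbert space has to be built from `f`; injectivity of `M` makes its range dense. -/
structure IsFactor (μ : Measure α) (f : α → Matrix m m ℂ) (M : α → Matrix m n ℂ) : Prop where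
  memLp : ∀ a j, MemLp (fun w => M w a j) 2 μ
  eq : ∀ᵐ w ∂μ, f w = M w * (M w)ᴴ
  inj : ∀ᵐ w ∂μ, Function.Injective (M w).mulVec

theorem IsFactor.eq_zero_of_conjTranspose_mulVec_eq_zero (hM : IsFactor μ f M)
    {h : Lp (EuclideanSpace ℂ n) 2 μ} (hz : ∀ᵐ w ∂μ, ∀ b, ∑ j, star (M w b j) * h w j = 0) :
    h = 0 := by
  rw [Lp.eq_zero_iff_ae_eq_zero]
  filter_upwards [hz, hM.inj] with w hw hinj
  have hstar : star (h w).ofLp = 0 := by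
    refine hinj ?_
    ext b
    simpa [Matrix.mulVec, dotProduct, mul_comm] using congrArg star (hw b)
  ext j
  simpa using congrFun hstar j

theorem IsFactor.integrable_apply (hM : IsFactor μ f M) (a b : m) :
    Integrable (fun w => f w a b) μ := by
  have hsum : Integrable (fun w => ∑ j, M w a j * star (M w b j)) μ :=
    integrable_finsetSum _ fun j _ =>
      MemLp.integrable_mul (p := 2) (q := 2) (hM.memLp a j) (hM.memLp b j).star
  refine hsum.congr ?_
  filter_upwards [hM.eq] with w hw
  rw [hw, Matrix.mul_apply]
  rfl

variable [Fintype m]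

namespace IsFactor

theorem aestronglyMeasurable_rowMul (hM : IsFactor μ f M) {g : α → m → ℂ}
    (hg : ∀ b, AEMeasurable (fun w => g w b) μ) : AEStronglyMeasurable (rowMul M g) μ := by
  refine AEMeasurable.aestronglyMeasurable
    ((WithLp.measurable_toLp 2 (n → ℂ)).comp_aemeasurable (aemeasurable_pi_lambda _ fun j => ?_))
  exact Finset.aemeasurable_fun_sum _ fun b _ =>
    (hg b).mul (hM.memLp b j).aestronglyMeasurable.aemeasurable

theorem memLp_rowMul (hM : IsFactor μ f M) {g : α → m → ℂ}
    (hg : ∀ b, MemLp (fun w => g w b) ∞ μ) : MemLp (rowMul M g) 2 μ :=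
  MemLp.of_eval_piLp fun j =>
    memLp_finsetSum _ fun b _ => MemLp.mul (p := ∞) (q := 2) (hM.memLp b j) (hg b)

theorem inner_toLp_eq_integral (hM : IsFactor μ f M) {g g' : α → m → ℂ}
    (hg : MemLp (rowMul M g) 2 μ) (hg' : MemLp (rowMul M g') 2 μ) :
    inner ℂ (hg.toLp _) (hg'.toLp _) = ∫ w, g' w ⬝ᵥ f w *ᵥ star (g w) ∂μ := by
  rw [L2.inner_def]
  refine integral_congr_ae ?_
  filter_upwards [hg.coeFn_toLp, hg'.coeFn_toLp, hM.eq] with w hgw hgw' hfw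
  rw [hgw, hgw', hfw, inner_rowMul]

theorem integrable_dotProduct_mulVec_star (hM : IsFactor μ f M) {g g' : α → m → ℂ}
    (hg : MemLp (rowMul M g) 2 μ) (hg' : MemLp (rowMul M g') 2 μ) :
    Integrable (fun w => g' w ⬝ᵥ f w *ᵥ star (g w)) μ := by
  refine (L2.integrable_inner (𝕜 := ℂ) (hg.toLp _) (hg'.toLp _)).congr ?_
  filter_upwards [hg.coeFn_toLp, hg'.coeFn_toLp, hM.eq] with w hgw hgw' hfw
  rw [hgw, hgw', hfw, inner_rowMul]

section Single

variable [DecidableEq m]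

theorem memLp_rowMul_single (hM : IsFactor μ f M) {φ : α → ℂ} (hφ : MemLp φ ∞ μ) (b : m) :
    MemLp (rowMul M fun w => Pi.single b (φ w)) 2 μ := by
  refine hM.memLp_rowMul fun b' => ?_
  rcases eq_or_ne b' b with rfl | hb
  · simpa only [Pi.single_eq_same] using hφ
  · simp only [Pi.single_eq_of_ne hb, MemLp.zero']

/-- The image under `g ↦ g M` of the row vector with `φ` in position `b` and zeros elsewhere. -/
noncomputable def singleRow (hM : IsFactor μ f M) {φ : α → ℂ} (hφ : MemLp φ ∞ μ) (b : m) :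
    Lp (EuclideanSpace ℂ n) 2 μ :=
  (hM.memLp_rowMul_single hφ b).toLp _

theorem inner_singleRow_singleRow (hM : IsFactor μ f M) {φ φ' : α → ℂ} (hφ : MemLp φ ∞ μ)
    (hφ' : MemLp φ' ∞ μ) (a b : m) :
    inner ℂ (hM.singleRow hφ b) (hM.singleRow hφ' a) = ∫ w, φ' w * star (φ w) * f w a b ∂μ := by
  rw [singleRow, singleRow, hM.inner_toLp_eq_integral]
  congr 1 with w
  rw [single_dotProduct, ← Pi.single_star, Matrix.mulVec_single, Pi.smul_apply,
    MulOpposite.smul_eq_mul_unop, MulOpposite.unop_op, Matrix.col_apply]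
  ring

theorem inner_singleRow_eq_integral (hM : IsFactor μ f M) {φ : α → ℂ} (hφ : MemLp φ ∞ μ) (b : m)
    (h : Lp (EuclideanSpace ℂ n) 2 μ) :
    inner ℂ (hM.singleRow hφ b) h = ∫ w, star (φ w) * ∑ j, star (M w b j) * h w j ∂μ := by
  rw [L2.inner_def]
  refine integral_congr_ae ?_
  filter_upwards [(hM.memLp_rowMul_single hφ b).coeFn_toLp] with w hw
  rw [singleRow, hw, EuclideanSpace.inner_eq_star_dotProduct, Finset.mul_sum]
  refine Finset.sum_congr rfl fun j _ => ?_
  simp only [rowMul, Matrix.single_vecMul, Pi.star_apply, Pi.smul_apply, Matrix.row_apply,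
    smul_eq_mul, star_mul']
  ring

theorem topologicalClosure_span_singleRow_eq_top (hM : IsFactor μ f M) {ι : Type*}
    {φ : ι → α → ℂ} (hφ : ∀ i, MemLp (φ i) ∞ μ)
    (hsep : ∀ h : α → ℂ, Integrable h μ → (∀ i, ∫ w, star (φ i w) * h w ∂μ = 0) → h =ᵐ[μ] 0) :
    (Submodule.span ℂ (Set.range fun p : ι × m =>
      hM.singleRow (hφ p.1) p.2)).topologicalClosure = ⊤ := by
  rw [Submodule.topologicalClosure_eq_top_iff, Submodule.eq_bot_iff]
  intro h hh
  rw [Submodule.mem_orthogonal] at hh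
  refine hM.eq_zero_of_conjTranspose_mulVec_eq_zero (ae_all_iff.2 fun b => hsep _ ?_ fun i => ?_)
  · exact integrable_finsetSum _ fun j _ =>
      MemLp.integrable_mul (p := 2) (q := 2) (hM.memLp b j).star ((Lp.memLp h).eval_piLp j)
  · rw [← hM.inner_singleRow_eq_integral (hφ i) b]
    exact hh _ (Submodule.subset_span ⟨(i, b), rfl⟩)

end Single

end IsFactor

theorem memLp_top_indicator_one {A : Set α} (hA : MeasurableSet A) :
    MemLp (A.indicator (1 : α → ℂ)) ∞ μ :=
  MemLp.indicator hA (memLp_top_const 1)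

namespace IsFactor

theorem memLp_rowMul_simpleFunc (hM : IsFactor μ f M) (s : SimpleFunc α (m → ℂ)) :
    MemLp (rowMul M s) 2 μ :=
  hM.memLp_rowMul fun b => SimpleFunc.memLp_top (s.map fun v : m → ℂ => v b) μ

/-- The image under `g ↦ g M` of a simple row vector function, as a linear map. -/
noncomputable def simpleRow (hM : IsFactor μ f M) :
    SimpleFunc α (m → ℂ) →ₗ[ℂ] Lp (EuclideanSpace ℂ n) 2 μ where
  toFun s := (hM.memLp_rowMul_simpleFunc s).toLp _
  map_add' s s' := by
    rw [← MemLp.toLp_add]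
    exact MemLp.toLp_congr _ _ (by rw [SimpleFunc.coe_add, rowMul_add])
  map_smul' c s := by
    rw [← MemLp.toLp_const_smul]
    exact MemLp.toLp_congr _ _ (by rw [SimpleFunc.coe_smul, rowMul_smul, RingHom.id_apply])

section Indicator

variable [DecidableEq m]

theorem simpleRow_piecewise (hM : IsFactor μ f M) {A : Set α} (hA : MeasurableSet A) (b : m) :
    hM.simpleRow (SimpleFunc.piecewise A hA (SimpleFunc.const α (Pi.single b 1)) 0) =
      hM.singleRow (memLp_top_indicator_one hA) b := by
  refine MemLp.toLp_congr (hM.memLp_rowMul_simpleFunc _)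
    (hM.memLp_rowMul_single (memLp_top_indicator_one hA) b) (ae_of_all _ fun w => ?_)
  by_cases hw : w ∈ A <;> simp [rowMul, hw]

theorem topologicalClosure_span_indicator_eq_top (hM : IsFactor μ f M) :
    (Submodule.span ℂ (Set.range fun p : {A : Set α // MeasurableSet A} × m =>
      hM.singleRow (memLp_top_indicator_one p.1.2) p.2)).topologicalClosure = ⊤ := by
  refine hM.topologicalClosure_span_singleRow_eq_top
    (φ := fun A : {A : Set α // MeasurableSet A} => A.1.indicator 1)
    (fun A => memLp_top_indicator_one A.2) fun h hh hz => ?_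
  refine hh.ae_eq_zero_of_forall_setIntegral_eq_zero fun A hA _ => ?_
  rw [← integral_indicator hA, ← hz ⟨A, hA⟩]
  congr 1 with w
  by_cases hw : w ∈ A <;> simp [hw]

end Indicator

theorem denseRange_simpleRow (hM : IsFactor μ f M) : DenseRange hM.simpleRow := by
  classical
  rw [DenseRange, ← LinearMap.coe_range, Submodule.dense_iff_topologicalClosure_eq_top,
    ← top_le_iff, ← hM.topologicalClosure_span_indicator_eq_top]
  refine Submodule.topologicalClosure_mono (Submodule.span_le.2 ?_)
  rintro _ ⟨⟨⟨A, hA⟩, b⟩, rfl⟩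
  exact ⟨_, hM.simpleRow_piecewise hA b⟩

end IsFactor

end Model

section Frequencies

variable {m n : Type*} [Fintype m] [Fintype n] [DecidableEq m]
  {f : ℝ → Matrix m m ℂ} {M : ℝ → Matrix m n ℂ}

/-- Lebesgue measure on the frequency interval. -/
noncomputable abbrev freqMeasure : Measure ℝ := volume.restrict freq

theorem memLp_top_exp (t : ℤ) :
    MemLp (fun w : ℝ => Complex.exp (Complex.I * (t : ℂ) * (w : ℂ))) ∞ freqMeasure := by
  refine MemLp.of_bound (Continuous.aestronglyMeasurable (by fun_prop)) 1 (ae_of_all _ fun w => ?_)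
  simp [Complex.norm_exp]

theorem star_exp (t : ℤ) (w : ℝ) : star (Complex.exp (Complex.I * (t : ℂ) * (w : ℂ))) =
    Complex.exp (Complex.I * ((-t : ℤ) : ℂ) * (w : ℂ)) := by
  rw [Complex.star_def, ← Complex.exp_conj]
  simp

theorem exp_mul_star_exp (s t : ℤ) (w : ℝ) :
    Complex.exp (Complex.I * (s : ℂ) * (w : ℂ)) *
      star (Complex.exp (Complex.I * (t : ℂ) * (w : ℂ))) =
    Complex.exp (Complex.I * ((s - t : ℤ) : ℂ) * (w : ℂ)) := by
  rw [star_exp, ← Complex.exp_add]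
  congr 1
  push_cast
  ring

theorem IsFactor.topologicalClosure_span_exp_eq_top (hM : IsFactor freqMeasure f M) :
    (Submodule.span ℂ (Set.range fun p : ℤ × m =>
      hM.singleRow (memLp_top_exp p.1) p.2)).topologicalClosure = ⊤ := by
  refine hM.topologicalClosure_span_singleRow_eq_top memLp_top_exp fun h hh hz => ?_
  refine ae_eq_zero_of_integral_exp_mul_eq_zero hh fun t => ?_
  simpa only [star_exp, neg_neg] using hz (-t)

end Frequencies

section SpectralNorm

theorem mul_mul_conjTranspose_apply {l m : Type*} [Fintype m] (A B : Matrix l m ℂ)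
    (F : Matrix m m ℂ) (a b : l) : (A * F * Bᴴ) a b = A a ⬝ᵥ F *ᵥ star (B b) := by
  rw [Matrix.mul_assoc, Matrix.mul_apply_eq_vecMul]
  simp only [Matrix.vecMul, dotProduct, Matrix.mulVec, Matrix.mul_apply]
  rfl

theorem re_trace_mul_mul_conjTranspose_mul_conjTranspose {l m n : Type*} [Fintype l] [Fintype m]
    [Fintype n] (A : Matrix l m ℂ) (M : Matrix m n ℂ) :
    (A * (M * Mᴴ) * Aᴴ).trace.re = ∑ a, ‖WithLp.toLp 2 (A a ᵥ* M)‖ ^ 2 := by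
  rw [← Matrix.mul_assoc, Matrix.mul_assoc (A * M), ← Matrix.conjTranspose_mul,
    re_trace_mul_conjTranspose_self]
  simp only [EuclideanSpace.norm_sq_eq, Matrix.mul_apply_eq_vecMul]

theorem tendsto_sum_sq_nhds_zero_iff {ι κ : Type*} [Fintype κ] {l : Filter ι}
    {u : ι → κ → ℝ≥0∞} :
    Tendsto (fun i => ∑ a, u i a ^ 2) l (𝓝 0) ↔ ∀ a, Tendsto (fun i => u i a) l (𝓝 0) := by
  refine ⟨fun h a => ?_, fun h => ?_⟩
  · have hsq : Tendsto (fun i => u i a ^ 2) l (𝓝 0) :=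
      tendsto_of_tendsto_of_tendsto_of_le_of_le tendsto_const_nhds h (fun _ => zero_le)
        fun i => Finset.single_le_sum (f := fun a => u i a ^ 2) (fun _ _ => zero_le)
          (Finset.mem_univ a)
    have hsqrt := ((ENNReal.continuous_rpow_const (y := 1 / 2)).tendsto 0).comp hsq
    simp only [Function.comp_def, ← ENNReal.rpow_natCast, ← ENNReal.rpow_mul] at hsqrt
    simpa using hsqrt
  · simpa using tendsto_finsetSum Finset.univ fun a _ => ENNReal.Tendsto.pow (n := 2) (h a)

namespace IsFactor

variable {n : Type*} [Fintype n] {d : ℕ} {f : ℝ → Matrix (Fin d) (Fin d) ℂ}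
  {M : ℝ → Matrix (Fin d) n ℂ} {G : ℝ → Matrix (Fin d) (Fin d) ℂ}

theorem specNormSq_eq_sum_eLpNorm (hM : IsFactor freqMeasure f M)
    (hG : ∀ a b, AEMeasurable (fun w => G w a b) freqMeasure) :
    specNormSq f G = ∑ a, eLpNorm (rowMul M fun w => G w a) 2 freqMeasure ^ 2 := by
  have hsq : ∀ a, eLpNorm (rowMul M fun w => G w a) 2 freqMeasure ^ 2 =
      ∫⁻ w in freq, ‖rowMul M (fun w => G w a) w‖ₑ ^ 2 := fun a => by
    simpa using eLpNorm_nnreal_pow_eq_lintegral (f := rowMul M fun w => G w a)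
      (μ := freqMeasure) (p := 2) two_ne_zero
  simp only [hsq]
  rw [← lintegral_finsetSum' _ fun a _ =>
    (hM.aestronglyMeasurable_rowMul fun b => hG a b).enorm.pow_const 2, specNormSq]
  refine lintegral_congr_ae ?_
  filter_upwards [hM.eq] with w hw
  rw [hw, re_trace_mul_mul_conjTranspose_mul_conjTranspose,
    ENNReal.ofReal_sum_of_nonneg fun a _ => sq_nonneg _]
  refine Finset.sum_congr rfl fun a _ => ?_
  rw [ENNReal.ofReal_pow (norm_nonneg _), ofReal_norm, rowMul]

theorem specNormSq_ne_top_iff (hM : IsFactor freqMeasure f M)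
    (hG : ∀ a b, AEMeasurable (fun w => G w a b) freqMeasure) :
    specNormSq f G ≠ ∞ ↔ ∀ a, MemLp (rowMul M fun w => G w a) 2 freqMeasure := by
  rw [hM.specNormSq_eq_sum_eLpNorm hG, ne_eq, ENNReal.sum_eq_top]
  simp only [Finset.mem_univ, true_and, not_exists, ENNReal.pow_eq_top_iff, ne_eq,
    OfNat.ofNat_ne_zero, not_false_eq_true, and_true]
  exact forall_congr' fun a =>
    ⟨fun h => ⟨hM.aestronglyMeasurable_rowMul (hG a), lt_top_iff_ne_top.2 h⟩,
      fun h => h.eLpNorm_ne_top⟩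

theorem tendsto_specNormSq_sub_iff (hM : IsFactor freqMeasure f M)
    (hG : ∀ a b, AEMeasurable (fun w => G w a b) freqMeasure)
    {S : ℕ → SimpleFunc ℝ (Matrix (Fin d) (Fin d) ℂ)} :
    Tendsto (fun k => specNormSq f fun w => G w - S k w) atTop (𝓝 0) ↔
      ∀ a, Tendsto (fun k => eLpNorm
        (rowMul M ((S k).map fun A => A a) - rowMul M fun w => G w a) 2 freqMeasure)
        atTop (𝓝 0) := by
  have hmeas : ∀ k a b, AEMeasurable (fun w => (G w - S k w) a b) freqMeasure := fun k a b =>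
    (hG a b).sub ((S k).map fun A : Matrix (Fin d) (Fin d) ℂ => A a b).measurable.aemeasurable
  have hrow : ∀ k a, rowMul M (fun w => (G w - S k w) a) =
      (rowMul M fun w => G w a) - rowMul M ((S k).map fun A => A a) := fun k a => rowMul_sub _ _
  simp only [fun k => hM.specNormSq_eq_sum_eLpNorm (hmeas k), tendsto_sum_sq_nhds_zero_iff, hrow,
    fun k a => eLpNorm_sub_comm (rowMul M fun w => G w a) (rowMul M ((S k).map fun A => A a))]

end IsFactor

end SpectralNorm

section SimpleFunctions

variable {α m : Type*} [MeasurableSpace α]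

theorem simpleFunc_sum_apply {ι E : Type*} [AddCommMonoid E] (s : Finset ι)
    (F : ι → SimpleFunc α E) (w : α) : (∑ i ∈ s, F i) w = ∑ i ∈ s, F i w :=
  map_sum (⟨⟨fun G => G w, rfl⟩, fun _ _ => rfl⟩ : SimpleFunc α E →+ E) F s

theorem map_row_eq_sum_piecewise [Fintype m] [DecidableEq m] {l : Type*}
    (S : SimpleFunc α (Matrix l m ℂ)) (a : l) :
    S.map (fun A => A a) = ∑ A ∈ S.range, ∑ b, A a b •
      SimpleFunc.piecewise (S ⁻¹' {A}) (S.measurableSet_fiber A)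
        (SimpleFunc.const α (Pi.single b 1)) 0 := by
  ext w b
  simp only [simpleFunc_sum_apply, SimpleFunc.map_apply]
  rw [Finset.sum_eq_single_of_mem (S w) (S.mem_range_self w) fun A _ hA =>
    Finset.sum_eq_zero fun b _ => by simp [hA.symm]]
  simp [Finset.sum_apply, Pi.single_apply]

/-- The simple matrix valued function with given rows. -/
def ofSimpleRows {l : Type*} [Finite l] (s : l → SimpleFunc α (m → ℂ)) :
    SimpleFunc α (Matrix l m ℂ) where
  toFun w := Matrix.of fun a => s a w
  measurableSet_fiber' A := by
    have hfiber : (fun w => Matrix.of fun a => s a w) ⁻¹' {A} = ⋂ a, s a ⁻¹' {A a} := by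
      ext w
      simp only [Set.mem_preimage, Set.mem_singleton_iff, Set.mem_iInter]
      exact funext_iff
    rw [hfiber]
    exact MeasurableSet.iInter fun a => (s a).measurableSet_fiber _
  finite_range' := by
    refine (Set.Finite.pi' fun a => (s a).finite_range).subset ?_
    rintro _ ⟨w, rfl⟩ a
    exact ⟨w, rfl⟩

end SimpleFunctions

section Integral

variable {Ω n : Type*} [MeasurableSpace Ω] [Fintype n] {P : Measure Ω} {d : ℕ}
  {f : ℝ → Matrix (Fin d) (Fin d) ℂ} {M : ℝ → Matrix (Fin d) n ℂ}
  {Z : VectorMeasure ℝ (L2Vec P d)} {G : ℝ → Matrix (Fin d) (Fin d) ℂ} {V : L2Vec P d}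

/-- The random measure `Z` has the covariance structure `E (Z(A) Z(B)^*) = ∫_{A ∩ B} f`. -/
def HasCov (f : ℝ → Matrix (Fin d) (Fin d) ℂ) (Z : VectorMeasure ℝ (L2Vec P d)) : Prop :=
  ∀ A B : Set ℝ, MeasurableSet A → MeasurableSet B → ∀ a b : Fin d,
    crossCov (Z A) (Z B) a b = ∫ w in A ∩ B ∩ freq, f w a b

namespace IsFactor

/-- The random measure `Z` comes from the isometry `J`, in that `J` maps the row `1_A e_b M`
to the component `Z_b(A)`. -/
def Induces (hM : IsFactor freqMeasure f M)
    (J : Lp (EuclideanSpace ℂ n) 2 freqMeasure →ₗᵢ[ℂ] Lp ℂ 2 P)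
    (Z : VectorMeasure ℝ (L2Vec P d)) : Prop :=
  ∀ (A : Set ℝ) (hA : MeasurableSet A) (b : Fin d),
    J (hM.singleRow (memLp_top_indicator_one hA) b) = component b (Z A)

variable {J : Lp (EuclideanSpace ℂ n) 2 freqMeasure →ₗᵢ[ℂ] Lp ℂ 2 P}

theorem inner_indicator (hM : IsFactor freqMeasure f M) {A B : Set ℝ} (hA : MeasurableSet A)
    (hB : MeasurableSet B) (a b : Fin d) :
    inner ℂ (hM.singleRow (memLp_top_indicator_one hB) b)
      (hM.singleRow (memLp_top_indicator_one hA) a) = ∫ w in A ∩ B ∩ freq, f w a b := by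
  rw [hM.inner_singleRow_singleRow, ← Measure.restrict_restrict (hA.inter hB),
    ← integral_indicator (hA.inter hB)]
  congr 1 with w
  by_cases hwA : w ∈ A <;> by_cases hwB : w ∈ B <;> simp [hwA, hwB]

theorem exists_induces (hM : IsFactor freqMeasure f M) (hZ : HasCov f Z) :
    ∃ J : Lp (EuclideanSpace ℂ n) 2 freqMeasure →ₗᵢ[ℂ] Lp ℂ 2 P, hM.Induces J Z := by
  obtain ⟨J, hJ⟩ := exists_linearIsometry_of_inner_eq
    (ψ := fun p : {A : Set ℝ // MeasurableSet A} × Fin d => component p.2 (Z p.1))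
    (fun p q => by rw [hM.inner_indicator q.1.2 p.1.2, ← crossCov_apply, hZ _ _ q.1.2 p.1.2])
    hM.topologicalClosure_span_indicator_eq_top
  exact ⟨J, fun A hA b => hJ (⟨A, hA⟩, b)⟩

theorem component_simpleIntegral {hM : IsFactor freqMeasure f M} (hJ : hM.Induces J Z)
    (S : SimpleFunc ℝ (Matrix (Fin d) (Fin d) ℂ)) (a : Fin d) :
    component a (simpleIntegral Z S) = J (hM.simpleRow (S.map fun A => A a)) := by
  simp only [simpleIntegral, map_row_eq_sum_piecewise, map_sum, map_smul, component_matAct,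
    hM.simpleRow_piecewise, hJ _ (S.measurableSet_fiber _)]

theorem exists_memLp_of_hasSpectralIntegral {hM : IsFactor freqMeasure f M} (hJ : hM.Induces J Z)
    (hV : HasSpectralIntegral f Z G V) (a : Fin d) :
    ∃ h : MemLp (rowMul M fun w => G w a) 2 freqMeasure, component a V = J (h.toLp _) := by
  obtain ⟨hG, S, hS, hSV⟩ := hV
  have hlim := (hM.tendsto_specNormSq_sub_iff hG).1 hS a
  have hGa : MemLp (rowMul M fun w => G w a) 2 freqMeasure := by
    obtain ⟨k, hk⟩ := (hlim.eventually (gt_mem_nhds ENNReal.zero_lt_top)).exists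
    have hSk := hM.memLp_rowMul_simpleFunc ((S k).map fun A => A a)
    have hsub : MemLp (rowMul M ((S k).map fun A => A a) - rowMul M fun w => G w a) 2
        freqMeasure := ⟨hSk.1.sub (hM.aestronglyMeasurable_rowMul (hG a)), hk⟩
    simpa only [sub_sub_cancel] using hSk.sub hsub
  have hrow : Tendsto (fun k => hM.simpleRow ((S k).map fun A => A a)) atTop
      (𝓝 (hGa.toLp _)) :=
    (Lp.tendsto_Lp_iff_tendsto_eLpNorm'' _ (fun k => hM.memLp_rowMul_simpleFunc _) _ hGa).2 hlim
  refine ⟨hGa, tendsto_nhds_unique (tendsto_iff_component.1 hSV a) ?_⟩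
  simp only [component_simpleIntegral hJ]
  exact (J.continuous.tendsto _).comp hrow

theorem hasSpectralIntegral_of_component_eq {hM : IsFactor freqMeasure f M} (hJ : hM.Induces J Z)
    (hG : ∀ a b, AEMeasurable (fun w => G w a b) freqMeasure)
    (hGM : ∀ a, MemLp (rowMul M fun w => G w a) 2 freqMeasure)
    (hV : ∀ a, component a V = J ((hGM a).toLp _)) : HasSpectralIntegral f Z G V := by
  have happrox : ∀ a, ∃ s : ℕ → SimpleFunc ℝ (Fin d → ℂ),
      Tendsto (fun k => hM.simpleRow (s k)) atTop (𝓝 ((hGM a).toLp _)) := fun a => by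
    obtain ⟨u, hu, hlim⟩ := mem_closure_iff_seq_limit.1 (hM.denseRange_simpleRow ((hGM a).toLp _))
    choose s hs using hu
    exact ⟨s, by simpa only [hs] using hlim⟩
  choose s hs using happrox
  refine ⟨hG, fun k => ofSimpleRows fun a => s a k, ?_, ?_⟩
  · exact (hM.tendsto_specNormSq_sub_iff hG).2 fun a =>
      (Lp.tendsto_Lp_iff_tendsto_eLpNorm'' _ (fun k => hM.memLp_rowMul_simpleFunc _) _
        (hGM a)).1 (hs a)
  · refine tendsto_iff_component.2 fun a => ?_
    simp only [component_simpleIntegral hJ, hV]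
    exact (J.continuous.tendsto _).comp (hs a)

end IsFactor

end Integral

section Existence

theorem inner_self_sub_sum_of_orthogonal {𝕜 ι H : Type*} [RCLike 𝕜] [NormedAddCommGroup H]
    [InnerProductSpace 𝕜 H] {v : ι → H} {x : H} (ho : ∀ i j, i ≠ j → inner 𝕜 (v i) (v j) = 0)
    (hx : ∀ i, inner 𝕜 (v i) x = inner 𝕜 (v i) (v i)) (s : Finset ι) :
    inner 𝕜 (x - ∑ i ∈ s, v i) (x - ∑ i ∈ s, v i) =
      inner 𝕜 x x - ∑ i ∈ s, inner 𝕜 (v i) (v i) := by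
  have horth : inner 𝕜 (∑ i ∈ s, v i) (x - ∑ i ∈ s, v i) = 0 := by
    rw [sum_inner]
    refine Finset.sum_eq_zero fun i hi => ?_
    rw [inner_sub_right, inner_sum,
      Finset.sum_eq_single_of_mem i hi fun j _ hj => ho i j hj.symm, hx, sub_self]
  rw [inner_sub_left, horth, sub_zero, inner_sub_right, inner_sum]
  congr 1
  refine Finset.sum_congr rfl fun i _ => ?_
  rw [← inner_conj_symm, hx, inner_conj_symm]

theorem hasSum_of_hasSum_inner_self {𝕜 ι H : Type*} [RCLike 𝕜] [NormedAddCommGroup H]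
    [InnerProductSpace 𝕜 H] {v : ι → H} {x : H} (ho : ∀ i j, i ≠ j → inner 𝕜 (v i) (v j) = 0)
    (hx : ∀ i, inner 𝕜 (v i) x = inner 𝕜 (v i) (v i))
    (hs : HasSum (fun i => inner 𝕜 (v i) (v i)) (inner 𝕜 x x)) : HasSum v x := by
  have hinner : Tendsto (fun s : Finset ι => inner 𝕜 (x - ∑ i ∈ s, v i) (x - ∑ i ∈ s, v i))
      atTop (𝓝 0) := by
    simpa only [inner_self_sub_sum_of_orthogonal ho hx, sub_self,
      SummationFilter.unconditional_filter] using
      tendsto_const_nhds (x := inner 𝕜 x x) |>.sub hs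
  have hsq : Tendsto (fun s : Finset ι => ‖x - ∑ i ∈ s, v i‖ ^ 2) atTop (𝓝 0) := by
    simpa [inner_self_eq_norm_sq_to_K] using hinner.norm
  refine tendsto_iff_norm_sub_tendsto_zero.2 ?_
  simpa [Real.sqrt_sq (norm_nonneg _), norm_sub_rev] using hsq.sqrt

namespace IsFactor

variable {Ω n : Type*} [MeasurableSpace Ω] [Fintype n] {P : Measure Ω} {d : ℕ}
  {f : ℝ → Matrix (Fin d) (Fin d) ℂ} {M : ℝ → Matrix (Fin d) n ℂ}
  {J : Lp (EuclideanSpace ℂ n) 2 freqMeasure →ₗᵢ[ℂ] Lp ℂ 2 P}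

theorem hasSum_singleRow_indicator (hM : IsFactor freqMeasure f M) {A : ℕ → Set ℝ}
    (hA : ∀ i, MeasurableSet (A i)) (hdisj : Pairwise (Function.onFun Disjoint A)) (b : Fin d) :
    HasSum (fun i => hM.singleRow (memLp_top_indicator_one (hA i)) b)
      (hM.singleRow (memLp_top_indicator_one (MeasurableSet.iUnion hA)) b) := by
  have hU := MeasurableSet.iUnion hA
  refine hasSum_of_hasSum_inner_self (𝕜 := ℂ) (fun i j hij => ?_) (fun i => ?_) ?_
  · rw [hM.inner_indicator (hA j) (hA i), (hdisj hij.symm).inter_eq, Set.empty_inter,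
      Measure.restrict_empty, integral_zero_measure]
  · rw [hM.inner_indicator hU (hA i), hM.inner_indicator (hA i) (hA i),
      Set.inter_eq_right.2 (Set.subset_iUnion A i), Set.inter_self]
  · simp only [hM.inner_indicator (hA _) (hA _), hM.inner_indicator hU hU, Set.inter_self,
      ← Measure.restrict_restrict (hA _), ← Measure.restrict_restrict hU]
    exact hasSum_integral_iUnion hA hdisj (hM.integrable_apply b b).integrableOn

open Classical in
/-- The random measure that comes from an isometry `J`; its value at a set that is not
measurable is `0`, as for every vector measure. -/
noncomputable def randomMeasure (hM : IsFactor freqMeasure f M)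
    (J : Lp (EuclideanSpace ℂ n) 2 freqMeasure →ₗᵢ[ℂ] Lp ℂ 2 P) :
    VectorMeasure ℝ (L2Vec P d) where
  measureOf' A := if hA : MeasurableSet A then
    ofComponents fun b => J (hM.singleRow (memLp_top_indicator_one hA) b) else 0
  empty' := by
    rw [dif_pos MeasurableSet.empty]
    refine ext_component fun b => ?_
    rw [component_ofComponents, map_zero, ← inner_self_eq_zero (𝕜 := ℂ), J.inner_map_map,
      hM.inner_indicator .empty .empty, Set.empty_inter, Set.empty_inter, Measure.restrict_empty,
      integral_zero_measure]
  not_measurable' A hA := dif_neg hA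
  m_iUnion' A hA hdisj := by
    simp only [hA, MeasurableSet.iUnion hA, dif_pos]
    refine tendsto_iff_component.2 fun b => ?_
    simp only [map_sum, component_ofComponents]
    exact (hM.hasSum_singleRow_indicator hA hdisj b).mapL J.toContinuousLinearMap

theorem induces_randomMeasure (hM : IsFactor freqMeasure f M)
    (J : Lp (EuclideanSpace ℂ n) 2 freqMeasure →ₗᵢ[ℂ] Lp ℂ 2 P) :
    hM.Induces J (hM.randomMeasure J) := by
  intro A hA b
  have hval : hM.randomMeasure J A =
      ofComponents fun b => J (hM.singleRow (memLp_top_indicator_one hA) b) := dif_pos hA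
  rw [hval, component_ofComponents]

theorem Induces.hasCov {hM : IsFactor freqMeasure f M} {Z : VectorMeasure ℝ (L2Vec P d)}
    (hJ : hM.Induces J Z) : HasCov f Z := by
  intro A B hA hB a b
  rw [crossCov_apply, ← hJ A hA, ← hJ B hB, J.inner_map_map, hM.inner_indicator hA hB]

end IsFactor

end Existence

section Filters

variable {Ω n : Type*} [MeasurableSpace Ω] [Fintype n] {P : Measure Ω} {d : ℕ}
  {f : ℝ → Matrix (Fin d) (Fin d) ℂ} {M : ℝ → Matrix (Fin d) n ℂ}
  {Z : VectorMeasure ℝ (L2Vec P d)}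

section SpectralIntegral

variable {G G' : ℝ → Matrix (Fin d) (Fin d) ℂ} {V V' : L2Vec P d}

theorem IsFactor.existsUnique_hasSpectralIntegral (hM : IsFactor freqMeasure f M)
    (hZ : HasCov f Z) (hG : ∀ a b, AEMeasurable (fun w => G w a b) freqMeasure)
    (hfin : specNormSq f G ≠ ∞) : ∃! V, HasSpectralIntegral f Z G V := by
  obtain ⟨J, hJ⟩ := hM.exists_induces hZ
  have hGM := (hM.specNormSq_ne_top_iff hG).1 hfin
  refine ⟨ofComponents fun a => J ((hGM a).toLp _), ?_, fun V hV => ext_component fun a => ?_⟩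
  · exact IsFactor.hasSpectralIntegral_of_component_eq hJ hG hGM fun a => component_ofComponents _ a
  · obtain ⟨_, hVa⟩ := IsFactor.exists_memLp_of_hasSpectralIntegral hJ hV a
    rw [hVa, component_ofComponents]

theorem IsFactor.hasSpectralIntegral_sub (hM : IsFactor freqMeasure f M) (hZ : HasCov f Z)
    (hV : HasSpectralIntegral f Z G V) (hV' : HasSpectralIntegral f Z G' V') :
    HasSpectralIntegral f Z (fun w => G w - G' w) (V - V') := by
  obtain ⟨J, hJ⟩ := hM.exists_induces hZ
  choose hGM hVJ using IsFactor.exists_memLp_of_hasSpectralIntegral hJ hV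
  choose hGM' hVJ' using IsFactor.exists_memLp_of_hasSpectralIntegral hJ hV'
  have hrow : ∀ a, (rowMul M fun w => (G w - G' w) a) =
      (rowMul M fun w => G w a) - rowMul M fun w => G' w a := fun a => rowMul_sub _ _
  refine IsFactor.hasSpectralIntegral_of_component_eq hJ (fun a b => (hV.1 a b).sub (hV'.1 a b))
    (fun a => by simpa only [hrow] using (hGM a).sub (hGM' a)) fun a => ?_
  rw [map_sub, hVJ, hVJ', ← map_sub, ← MemLp.toLp_sub]
  simp only [hrow]

theorem IsFactor.crossCov_eq_integral (hM : IsFactor freqMeasure f M) (hZ : HasCov f Z)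
    (hV : HasSpectralIntegral f Z G V) (hV' : HasSpectralIntegral f Z G' V') (a b : Fin d) :
    crossCov V V' a b = ∫ w in freq, G w a ⬝ᵥ f w *ᵥ star (G' w b) := by
  obtain ⟨J, hJ⟩ := hM.exists_induces hZ
  obtain ⟨hGM, hVJ⟩ := IsFactor.exists_memLp_of_hasSpectralIntegral hJ hV a
  obtain ⟨hGM', hVJ'⟩ := IsFactor.exists_memLp_of_hasSpectralIntegral hJ hV' b
  rw [crossCov_apply, hVJ, hVJ', J.inner_map_map, hM.inner_toLp_eq_integral]

theorem IsFactor.integrableOn_dotProduct_mulVec_star (hM : IsFactor freqMeasure f M)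
    (hZ : HasCov f Z) (hV : HasSpectralIntegral f Z G V) (a b : Fin d) :
    IntegrableOn (fun w => G w a ⬝ᵥ f w *ᵥ star (G w b)) freq := by
  obtain ⟨J, hJ⟩ := hM.exists_induces hZ
  obtain ⟨ha, _⟩ := IsFactor.exists_memLp_of_hasSpectralIntegral hJ hV a
  obtain ⟨hb, _⟩ := IsFactor.exists_memLp_of_hasSpectralIntegral hJ hV b
  exact hM.integrable_dotProduct_mulVec_star hb ha

end SpectralIntegral

variable {T T' : ℝ → Matrix (Fin d) (Fin d) ℂ} {Y Y' : ℤ → L2Vec P d}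

/-- The transfer function `e^{itω} T(ω)`, whose spectral integral is the value at time `t` of the
filtered process. -/
noncomputable def modulate (T : ℝ → Matrix (Fin d) (Fin d) ℂ) (t : ℤ) :
    ℝ → Matrix (Fin d) (Fin d) ℂ :=
  fun w => Complex.exp (Complex.I * (t : ℂ) * (w : ℂ)) • T w

theorem modulate_zero : modulate T 0 = T := by
  funext w
  simp [modulate]

theorem aemeasurable_modulate (hT : ∀ a b, AEMeasurable (fun w => T w a b) freqMeasure) (t : ℤ)
    (a b : Fin d) : AEMeasurable (fun w => modulate T t w a b) freqMeasure :=
  (memLp_top_exp t).aestronglyMeasurable.aemeasurable.mul (hT a b)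

theorem modulate_mul_mul_conjTranspose_modulate (F : Matrix (Fin d) (Fin d) ℂ) (s t : ℤ) (w : ℝ) :
    modulate T s w * F * (modulate T t w)ᴴ =
      Complex.exp (Complex.I * ((s - t : ℤ) : ℂ) * (w : ℂ)) • (T w * F * (T w)ᴴ) := by
  rw [modulate, modulate, Matrix.conjTranspose_smul, Matrix.smul_mul, Matrix.smul_mul,
    Matrix.mul_smul, smul_smul, exp_mul_star_exp]

theorem specNormSq_modulate (t : ℤ) : specNormSq f (modulate T t) = specNormSq f T := by
  simp [specNormSq, modulate_mul_mul_conjTranspose_modulate]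

theorem IsFactor.existsUnique_isFiltered (hM : IsFactor freqMeasure f M) (hZ : HasCov f Z)
    (hT : ∀ a b, AEMeasurable (fun w => T w a b) freqMeasure) (hfin : specNormSq f T ≠ ∞) :
    ∃! Y, IsFiltered f Z T Y := by
  have hex : ∀ t, ∃! V, HasSpectralIntegral f Z (modulate T t) V := fun t =>
    hM.existsUnique_hasSpectralIntegral hZ (aemeasurable_modulate hT t)
      (by rwa [specNormSq_modulate])
  choose Y hY huniq using hex
  exact ⟨Y, hY, fun Y' hY' => funext fun t => huniq t (Y' t) (hY' t)⟩

theorem IsFactor.isFiltered_sub (hM : IsFactor freqMeasure f M) (hZ : HasCov f Z)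
    (hY : IsFiltered f Z T Y) (hY' : IsFiltered f Z T' Y') :
    IsFiltered f Z (fun w => T w - T' w) (fun t => Y t - Y' t) := by
  intro t
  simpa only [smul_sub] using hM.hasSpectralIntegral_sub hZ (hY t) (hY' t)

theorem IsFactor.isSpectralDensity_of_isFiltered (hM : IsFactor freqMeasure f M)
    (hZ : HasCov f Z) (hY : IsFiltered f Z T Y) :
    IsSpectralDensity Y fun w => T w * f w * (T w)ᴴ := by
  have hform : ∀ s t w a b, modulate T s w a ⬝ᵥ f w *ᵥ star (modulate T t w b) =
      Complex.exp (Complex.I * ((s - t : ℤ) : ℂ) * (w : ℂ)) * (T w * f w * (T w)ᴴ) a b := by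
    intro s t w a b
    rw [← mul_mul_conjTranspose_apply, modulate_mul_mul_conjTranspose_modulate, Matrix.smul_apply,
      smul_eq_mul]
  refine ⟨fun a b => ?_, ?_, fun t h a b => ?_⟩
  · have h0 : HasSpectralIntegral f Z (modulate T 0) (Y 0) := hY 0
    rw [modulate_zero] at h0
    simpa only [mul_mul_conjTranspose_apply] using
      hM.integrableOn_dotProduct_mulVec_star hZ h0 a b
  · filter_upwards [hM.eq] with w hw
    rw [hw]
    exact (Matrix.posSemidef_self_mul_conjTranspose (M w)).mul_mul_conjTranspose_same (T w)
  · rw [hM.crossCov_eq_integral hZ (hY (t + h)) (hY t)]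
    simpa only [modulate, add_sub_cancel_left] using
      congrArg (fun F : ℝ → ℂ => ∫ w in freq, F w) (funext fun w => hform (t + h) t w a b)

end Filters

section Density

variable {Ω : Type*} [MeasurableSpace Ω] {P : Measure Ω} {d : ℕ} {Y : ℤ → L2Vec P d}
  {g g' : ℝ → Matrix (Fin d) (Fin d) ℂ}

theorem ae_eq_of_isSpectralDensity (hg : IsSpectralDensity Y g) (hg' : IsSpectralDensity Y g') :
    ∀ᵐ w ∂freqMeasure, g w = g' w := by
  have hzero : ∀ᵐ w ∂freqMeasure, ∀ a b, g w a b - g' w a b = 0 := by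
    refine ae_all_iff.2 fun a => ae_all_iff.2 fun b => ?_
    refine ae_eq_zero_of_integral_exp_mul_eq_zero
      ((hg.integrable a b).sub (hg'.integrable a b)) fun t => ?_
    have hint : ∀ {h : ℝ → ℂ}, IntegrableOn h freq → IntegrableOn
        (fun w : ℝ => Complex.exp (Complex.I * (t : ℂ) * (w : ℂ)) * h w) freq := fun hh =>
      memLp_one_iff_integrable.1 ((memLp_one_iff_integrable.2 hh).mul (p := ∞) (memLp_top_exp t))
    simp only [mul_sub]
    rw [integral_sub (hint (hg.integrable a b)) (hint (hg'.integrable a b)), ← hg.cov_eq 0,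
      ← hg'.cov_eq 0, sub_self]
  filter_upwards [hzero] with w hw
  ext a b
  exact sub_eq_zero.1 (hw a b)

theorem isStationary_of_isSpectralDensity (hg : IsSpectralDensity Y g)
    (hY : ∀ t, ∫ x, Y t x ∂P = 0) : IsStationary Y :=
  ⟨hY, fun s t h => Matrix.ext fun a b => by rw [hg.cov_eq, hg.cov_eq]⟩

theorem integrableOn_trace_of_isSpectralDensity (hg : IsSpectralDensity Y g) :
    IntegrableOn (fun w => (g w).trace) freq :=
  integrable_finsetSum _ fun a _ => hg.integrable a a

theorem norm_sq_eq_integral_re_trace (hg : IsSpectralDensity Y g) (t : ℤ) :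
    ‖Y t‖ ^ 2 = ∫ w in freq, (g w).trace.re := by
  have htrace : (crossCov (Y t) (Y t)).trace = ∫ w in freq, (g w).trace := by
    simp only [Matrix.trace, Matrix.diag_apply]
    rw [integral_finsetSum _ fun a _ => hg.integrable a a]
    refine Finset.sum_congr rfl fun a _ => ?_
    simpa using hg.cov_eq t 0 a a
  rw [trace_crossCov_self] at htrace
  rw [← Complex.ofReal_re (‖Y t‖ ^ 2), htrace]
  exact (integral_re (integrableOn_trace_of_isSpectralDensity hg)).symm

end Density

section Cramer

variable {Ω n : Type*} [MeasurableSpace Ω] [Fintype n] {P : Measure Ω} {d : ℕ}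
  {f : ℝ → Matrix (Fin d) (Fin d) ℂ} {M : ℝ → Matrix (Fin d) n ℂ}
  {Z : VectorMeasure ℝ (L2Vec P d)} {X Y : ℤ → L2Vec P d}

theorem IsFactor.isFiltered_one_iff {hM : IsFactor freqMeasure f M}
    {J : Lp (EuclideanSpace ℂ n) 2 freqMeasure →ₗᵢ[ℂ] Lp ℂ 2 P} (hJ : hM.Induces J Z) :
    IsFiltered f Z (fun _ => 1) X ↔
      ∀ t a, J (hM.singleRow (memLp_top_exp t) a) = component a (X t) := by
  have hrow : ∀ (t : ℤ) (a : Fin d),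
      (fun w : ℝ => (Complex.exp (Complex.I * (t : ℂ) * (w : ℂ)) •
        (1 : Matrix (Fin d) (Fin d) ℂ)) a) =
      fun w : ℝ => Pi.single a (Complex.exp (Complex.I * (t : ℂ) * (w : ℂ))) := fun t a => by
    funext w b
    rcases eq_or_ne a b with rfl | hb
    · simp
    · simp [hb, hb.symm]
  refine ⟨fun h t a => ?_, fun h t => ?_⟩
  · obtain ⟨_, hX⟩ := IsFactor.exists_memLp_of_hasSpectralIntegral hJ (h t) a
    simp only [hrow] at hX
    exact hX.symm
  · refine IsFactor.hasSpectralIntegral_of_component_eq hJ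
      (aemeasurable_modulate (T := fun _ => 1) (fun _ _ => aemeasurable_const) t)
      (fun a => by simpa only [hrow] using hM.memLp_rowMul_single (memLp_top_exp t) a) fun a => ?_
    rw [← h t a]
    simp only [hrow]
    rfl

theorem IsFactor.existsUnique_isCramerMeasure (hM : IsFactor freqMeasure f M)
    (hf : IsSpectralDensity X f) : ∃! Z, IsCramerMeasure X f Z := by
  obtain ⟨J, hJ⟩ := exists_linearIsometry_of_inner_eq
    (φ := fun p : ℤ × Fin d => hM.singleRow (memLp_top_exp p.1) p.2)
    (ψ := fun p => component p.2 (X p.1)) (fun p q => by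
      rw [hM.inner_singleRow_singleRow, ← crossCov_apply]
      simp only [exp_mul_star_exp]
      rw [← hf.cov_eq p.1, add_sub_cancel]) hM.topologicalClosure_span_exp_eq_top
  have hind := hM.induces_randomMeasure J
  refine ⟨hM.randomMeasure J,
    ⟨hind.hasCov, (IsFactor.isFiltered_one_iff hind).2 fun t a => hJ (t, a)⟩, fun Z hZ => ?_⟩
  obtain ⟨J', hJ'⟩ := hM.exists_induces hZ.cov_eq
  obtain rfl : J' = J := linearIsometry_eq_of_eqOn_total hM.topologicalClosure_span_exp_eq_top
    fun p => by rw [hJ p, ← (IsFactor.isFiltered_one_iff hJ').1 hZ.represents]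
  refine VectorMeasure.ext fun A hA => ext_component fun b => ?_
  rw [← hJ' A hA b, hind A hA b]

theorem integral_component [IsFiniteMeasure P] (V : L2Vec P d) (a : Fin d) :
    ∫ x, component a V x ∂P = (∫ x, V x ∂P) a := by
  rw [eval_integral_piLp fun a => ((Lp.memLp V).eval_piLp a).integrable one_le_two]
  exact integral_congr_ae (coeFn_component a V)

theorem IsFactor.integral_map_eq_zero [IsFiniteMeasure P] (hM : IsFactor freqMeasure f M)
    {J : Lp (EuclideanSpace ℂ n) 2 freqMeasure →ₗᵢ[ℂ] Lp ℂ 2 P}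
    (hJ : ∀ (t : ℤ) a, ∫ x, J (hM.singleRow (memLp_top_exp t) a) x ∂P = 0)
    (h : Lp (EuclideanSpace ℂ n) 2 freqMeasure) : ∫ x, J h x ∂P = 0 := by
  let expectation : Lp ℂ 2 P →L[ℂ] ℂ :=
    innerSL ℂ (indicatorConstLp 2 MeasurableSet.univ (measure_ne_top P _) (1 : ℂ))
  have hexp : ∀ v, expectation v = ∫ x, v x ∂P := fun v => by
    rw [← setIntegral_univ]
    exact L2.inner_indicatorConstLp_one MeasurableSet.univ (measure_ne_top P _) v
  have hzero : expectation.comp J.toContinuousLinearMap = 0 := by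
    refine ContinuousLinearMap.ext_on (Submodule.dense_iff_topologicalClosure_eq_top.2
      hM.topologicalClosure_span_exp_eq_top) ?_
    rintro _ ⟨p, rfl⟩
    exact (hexp _).trans (hJ p.1 p.2)
  rw [← hexp]
  exact congrArg (fun L => L h) hzero

theorem IsFactor.integral_eq_zero_of_isFiltered [IsFiniteMeasure P]
    (hM : IsFactor freqMeasure f M) (hZ : IsCramerMeasure X f Z) (hX : ∀ t, ∫ x, X t x ∂P = 0)
    {T : ℝ → Matrix (Fin d) (Fin d) ℂ} (hY : IsFiltered f Z T Y) (t : ℤ) :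
    ∫ x, Y t x ∂P = 0 := by
  obtain ⟨J, hJ⟩ := hM.exists_induces hZ.cov_eq
  ext a
  obtain ⟨_, hYa⟩ := IsFactor.exists_memLp_of_hasSpectralIntegral hJ (hY t) a
  rw [← integral_component, hYa]
  refine hM.integral_map_eq_zero (fun t a => ?_) _
  rw [(IsFactor.isFiltered_one_iff hJ).1 hZ.represents, integral_component, hX]
  rfl

end Cramer

section Decomposition

variable {d r k : ℕ} {f : ℝ → Matrix (Fin d) (Fin d) ℂ} {lam : ℕ → ℝ → ℝ}
  {U : ℝ → Matrix (Fin d) (Fin r) ℂ}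

theorem sum_Icc_eq_sum_fin (k r : ℕ) (g : ℕ → ℝ) :
    ∑ j ∈ Finset.Icc (k + 1) r, g j = ∑ j : Fin r with k ≤ j.val, g (j.val + 1) := by
  rw [Finset.sum_filter, Fin.sum_univ_eq_sum_range (fun i => if k ≤ i then g (i + 1) else 0) r,
    ← Finset.sum_filter]
  refine (Finset.sum_nbij' (· + 1) (· - 1) ?_ ?_ ?_ ?_ fun _ _ => rfl).symm <;>
    grind

theorem sum_Icc_one_eq_sum_fin (r : ℕ) (g : ℕ → ℝ) :
    ∑ j ∈ Finset.Icc 1 r, g j = ∑ j : Fin r, g (j.val + 1) := by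
  simpa using sum_Icc_eq_sum_fin 0 r g

theorem norm_apply_sq_le_norm_mul_conjTranspose_apply {m n : Type*} [Fintype n]
    (M : Matrix m n ℂ) (a : m) (j : n) : ‖M a j‖ ^ 2 ≤ ‖(M * Mᴴ) a a‖ := by
  have hdiag : (M * Mᴴ) a a = ((∑ j, ‖M a j‖ ^ 2 : ℝ) : ℂ) := by
    simp only [Matrix.mul_apply, Matrix.conjTranspose_apply, Complex.star_def, Complex.mul_conj',
      Complex.ofReal_sum, Complex.ofReal_pow]
  rw [hdiag, Complex.norm_real, Real.norm_of_nonneg (Finset.sum_nonneg fun _ _ => sq_nonneg _)]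
  exact Finset.single_le_sum (f := fun j => ‖M a j‖ ^ 2) (fun _ _ => sq_nonneg _)
    (Finset.mem_univ j)

theorem neBot_ae_freqMeasure : (ae freqMeasure).NeBot := by
  rw [ae_neBot, Ne, Measure.restrict_eq_zero, Real.volume_Icc]
  simp [Real.pi_pos]

theorem integral_freq_const (c : ℝ) : ∫ _ in freq, c = 2 * Real.pi * c := by
  rw [setIntegral_const, Real.volume_real_Icc_of_le (by linarith [Real.pi_pos]), smul_eq_mul]
  ring

namespace IsSpectralDecomposition

theorem ae_pos (h : IsSpectralDecomposition r f lam U) :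
    ∀ᵐ w ∂freqMeasure, ∀ j : Fin r, 0 < lam (j.val + 1) w := by
  filter_upwards [h.pos] with w hw j
  exact hw _ (by omega) (by omega)

theorem ae_antitone (h : IsSpectralDecomposition r f lam U) :
    ∀ᵐ w ∂freqMeasure, Antitone fun j : Fin r => lam (j.val + 1) w := by
  filter_upwards [h.antitone] with w hw i j hij
  exact hw _ _ (by omega) (Nat.succ_le_succ hij) (by omega)

theorem aemeasurable_lam (h : IsSpectralDecomposition r f lam U)
    (hf : ∀ a b, AEMeasurable (fun w => f w a b) freqMeasure) (j : Fin r) :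
    AEMeasurable (lam (j.val + 1)) freqMeasure := by
  have hcompress : AEMeasurable (fun w => (((U w)ᴴ * f w * U w) j j).re) freqMeasure := by
    simp only [Matrix.mul_apply, Matrix.conjTranspose_apply]
    exact Complex.measurable_re.comp_aemeasurable <| Finset.aemeasurable_fun_sum _ fun b _ =>
      (Finset.aemeasurable_fun_sum _ fun a _ =>
        (continuous_star.measurable.comp_aemeasurable (h.measurable a j)).mul (hf a b)).mul
        (h.measurable b j)
  refine hcompress.congr ?_
  filter_upwards [h.orthonormal, h.decomp] with w hU hdec
  rw [hdec, conjTranspose_mul_conj_mul hU, Matrix.diagonal_apply_eq, Complex.ofReal_re]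

theorem aemeasurable_projFilter (h : IsSpectralDecomposition r f lam U) (hk : k ≤ r)
    (a b : Fin d) : AEMeasurable (fun w => projFilter hk U w a b) freqMeasure := by
  simp only [projFilter, Matrix.mul_apply, Matrix.conjTranspose_apply, firstCols,
    Matrix.submatrix_apply, id]
  exact Finset.aemeasurable_fun_sum _ fun j _ => (h.measurable _ _).mul
    (continuous_star.measurable.comp_aemeasurable (h.measurable _ _))

theorem isFactor (h : IsSpectralDecomposition r f lam U)
    (hf : ∀ a b, IntegrableOn (fun w => f w a b) freq) :
    IsFactor freqMeasure f fun w => sqrtFactor (U w) fun j => lam (j.val + 1) w := by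
  have heq : ∀ᵐ w ∂freqMeasure, f w = sqrtFactor (U w) (fun j => lam (j.val + 1) w) *
      (sqrtFactor (U w) fun j => lam (j.val + 1) w)ᴴ := by
    filter_upwards [h.ae_pos, h.decomp] with w hpos hdec
    rw [hdec, sqrtFactor_mul_conjTranspose _ fun j => (hpos j).le]
  refine ⟨fun a j => ?_, heq, ?_⟩
  · have hmeas : AEStronglyMeasurable
        (fun w => sqrtFactor (U w) (fun j => lam (j.val + 1) w) a j) freqMeasure := by
      simp only [sqrtFactor, Matrix.mul_diagonal]
      exact ((h.measurable a j).mul <| Complex.measurable_ofReal.comp_aemeasurable <|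
        Real.continuous_sqrt.measurable.comp_aemeasurable <| h.aemeasurable_lam
          (fun a b => (hf a b).aestronglyMeasurable.aemeasurable) j).aestronglyMeasurable
    rw [memLp_two_iff_integrable_sq_norm hmeas]
    refine (hf a a).norm.mono' (hmeas.norm.pow 2) ?_
    filter_upwards [heq] with w hw
    rw [Real.norm_of_nonneg (sq_nonneg _), hw]
    exact norm_apply_sq_le_norm_mul_conjTranspose_apply _ a j
  · filter_upwards [h.ae_pos, h.orthonormal] with w hpos hU
    exact injective_mulVec_sqrtFactor hU hpos

theorem re_trace_eq (h : IsSpectralDecomposition r f lam U) :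
    ∀ᵐ w ∂freqMeasure, (f w).trace.re = ∑ j ∈ Finset.Icc 1 r, lam j w := by
  filter_upwards [h.orthonormal, h.decomp] with w hU hdec
  rw [hdec, trace_conj_of_conjTranspose_mul_self hU, Matrix.trace_diagonal, ← Complex.ofReal_sum,
    Complex.ofReal_re, sum_Icc_one_eq_sum_fin r fun j => lam j w]

theorem re_trace_projFilter (h : IsSpectralDecomposition r f lam U) (hk : k ≤ r) :
    ∀ᵐ w ∂freqMeasure, (projFilter hk U w * f w * (projFilter hk U w)ᴴ).trace.re =
      ∑ j ∈ Finset.Icc 1 k, lam j w := by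
  filter_upwards [h.orthonormal, h.decomp] with w hU hdec
  rw [projFilter, proj_mul_mul_proj,
    trace_conj_of_conjTranspose_mul_self (conjTranspose_firstCols_mul_firstCols hk hU), hdec,
    conjTranspose_firstCols_mul_mul_firstCols hk hU, Matrix.trace_diagonal, ← Complex.ofReal_sum,
    Complex.ofReal_re, sum_Icc_one_eq_sum_fin k fun j => lam j w]
  rfl

theorem re_trace_one_sub_projFilter (h : IsSpectralDecomposition r f lam U) (hk : k ≤ r) :
    ∀ᵐ w ∂freqMeasure, ((1 - projFilter hk U w) * f w * (1 - projFilter hk U w)ᴴ).trace.re =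
      ∑ j ∈ Finset.Icc (k + 1) r, lam j w := by
  filter_upwards [h.orthonormal, h.decomp] with w hU hdec
  rw [projFilter, hdec, trace_one_sub_proj_firstCols hk hU, Complex.ofReal_re,
    sum_Icc_eq_sum_fin k r fun j => lam j w]

theorem sum_tail_le_re_trace (h : IsSpectralDecomposition r f lam U) (hk : k ≤ r)
    {T : ℝ → Matrix (Fin d) (Fin d) ℂ}
    (hT : ∀ᵐ w ∂freqMeasure, (T w * f w * (T w)ᴴ).rank ≤ k) :
    ∀ᵐ w ∂freqMeasure, ∑ j ∈ Finset.Icc (k + 1) r, lam j w ≤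
      ((1 - T w) * f w * (1 - T w)ᴴ).trace.re := by
  filter_upwards [h.orthonormal, h.decomp, h.ae_pos, h.ae_antitone, hT] with w hU hdec hpos hl hrank
  rw [sum_Icc_eq_sum_fin k r fun j => lam j w]
  exact sum_tail_le_re_trace_of_rank_le hk hU (fun j => (hpos j).le) hl hdec hrank

theorem rank_projFilter (h : IsSpectralDecomposition r f lam U) (hk : k ≤ r) :
    ∀ᵐ w ∂freqMeasure, (projFilter hk U w).rank = k := by
  filter_upwards [h.orthonormal] with w hU
  rw [projFilter, Matrix.rank_self_mul_conjTranspose, ← Matrix.rank_conjTranspose_mul_self,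
    conjTranspose_firstCols_mul_firstCols hk hU, Matrix.rank_one, Fintype.card_fin]

theorem rank_projFilter_mul_mul (h : IsSpectralDecomposition r f lam U) (hk : k ≤ r) :
    ∀ᵐ w ∂freqMeasure, (projFilter hk U w * f w * (projFilter hk U w)ᴴ).rank = k := by
  filter_upwards [h.orthonormal, h.decomp, h.ae_pos] with w hU hdec hpos
  have hne : ∀ j : Fin k, (lam ((Fin.castLE hk j).val + 1) w : ℂ) ≠ 0 := fun j =>
    mod_cast (hpos _).ne'
  rw [projFilter, proj_mul_mul_proj,
    rank_conj_of_conjTranspose_mul_self (conjTranspose_firstCols_mul_firstCols hk hU), hdec,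
    conjTranspose_firstCols_mul_mul_firstCols hk hU, Matrix.rank_diagonal]
  simp only [ne_eq, hne, not_false_eq_true, Fintype.card_subtype_true, Fintype.card_fin]

theorem integrableOn_lam (h : IsSpectralDecomposition r f lam U)
    (hf : ∀ a b, IntegrableOn (fun w => f w a b) freq) {j : ℕ} (hj : 1 ≤ j) (hjr : j ≤ r) :
    IntegrableOn (lam j) freq := by
  obtain ⟨i, rfl⟩ := Nat.exists_eq_add_of_le' hj
  have htrace : IntegrableOn (fun w => (f w).trace.re) freq :=
    (integrable_finsetSum _ fun a _ => hf a a).re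
  refine htrace.mono' (h.aemeasurable_lam
    (fun a b => (hf a b).aestronglyMeasurable.aemeasurable) ⟨i, hjr⟩).aestronglyMeasurable ?_
  filter_upwards [h.re_trace_eq, h.pos] with w htr hpos
  rw [htr, Real.norm_of_nonneg (hpos _ hj hjr).le]
  refine Finset.single_le_sum (f := fun j => lam j w) (fun i hi => ?_) (Finset.mem_Icc.2 ⟨hj, hjr⟩)
  exact (hpos i (Finset.mem_Icc.1 hi).1 (Finset.mem_Icc.1 hi).2).le

theorem integrableOn_sum_lam (h : IsSpectralDecomposition r f lam U)
    (hf : ∀ a b, IntegrableOn (fun w => f w a b) freq) {p q : ℕ} (hp : 1 ≤ p) (hq : q ≤ r) :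
    IntegrableOn (fun w => ∑ j ∈ Finset.Icc p q, lam j w) freq :=
  integrable_finsetSum _ fun _ hj => h.integrableOn_lam hf
    (hp.trans (Finset.mem_Icc.1 hj).1) ((Finset.mem_Icc.1 hj).2.trans hq)

theorem specNormSq_projFilter_ne_top (h : IsSpectralDecomposition r f lam U)
    (hf : ∀ a b, IntegrableOn (fun w => f w a b) freq) (hk : k ≤ r) :
    specNormSq f (projFilter hk U) ≠ ∞ :=
  (((h.integrableOn_sum_lam hf le_rfl hk).congr
    ((h.re_trace_projFilter hk).mono fun _ hw => hw.symm)).lintegral_lt_top).ne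

theorem integral_sum_lam_pos (h : IsSpectralDecomposition r f lam U)
    (hf : ∀ a b, IntegrableOn (fun w => f w a b) freq) (hr : 1 ≤ r) :
    0 < ∫ w in freq, ∑ j ∈ Finset.Icc 1 r, lam j w := by
  have hpos : ∀ᵐ w ∂freqMeasure, 0 < ∑ j ∈ Finset.Icc 1 r, lam j w := by
    filter_upwards [h.pos] with w hw
    exact Finset.sum_pos (fun j hj => hw j (Finset.mem_Icc.1 hj).1 (Finset.mem_Icc.1 hj).2)
      ⟨1, Finset.mem_Icc.2 ⟨le_rfl, hr⟩⟩
  have hnonneg : 0 ≤ᵐ[freqMeasure] fun w => ∑ j ∈ Finset.Icc 1 r, lam j w :=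
    hpos.mono fun w hw => hw.le
  refine (integral_nonneg_of_ae hnonneg).lt_of_ne' fun hzero => ?_
  have hae := (integral_eq_zero_iff_of_nonneg_ae hnonneg
    (h.integrableOn_sum_lam hf le_rfl le_rfl)).1 hzero
  have := neBot_ae_freqMeasure
  obtain ⟨w, hw, hw0⟩ := (hpos.and hae).exists
  exact hw.ne' hw0

theorem integral_sum_tail_le (h : IsSpectralDecomposition r f lam U)
    (hf : ∀ a b, IntegrableOn (fun w => f w a b) freq) (hk : k ≤ r) {ε : ℝ}
    (hε : ∀ᵐ w ∂freqMeasure, lam (k + 1) w ≤ ε) :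
    ∫ w in freq, ∑ j ∈ Finset.Icc (k + 1) r, lam j w ≤ 2 * Real.pi * (((r : ℝ) - k) * ε) := by
  rw [← integral_freq_const]
  refine integral_mono_ae (h.integrableOn_sum_lam hf (Nat.le_add_left 1 k) le_rfl)
    (integrable_const _) ?_
  filter_upwards [hε, h.antitone] with w hw hanti
  calc ∑ j ∈ Finset.Icc (k + 1) r, lam j w ≤ ∑ _j ∈ Finset.Icc (k + 1) r, ε :=
        Finset.sum_le_sum fun j hj => (hanti (k + 1) j (Nat.le_add_left 1 k)
          (Finset.mem_Icc.1 hj).1 (Finset.mem_Icc.1 hj).2).trans hw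
    _ = ((r : ℝ) - k) * ε := by
        rw [Finset.sum_const, Nat.card_Icc, nsmul_eq_mul, Nat.add_sub_add_right, Nat.cast_sub hk]

theorem le_integral_sum (h : IsSpectralDecomposition r f lam U)
    (hf : ∀ a b, IntegrableOn (fun w => f w a b) freq) (hk : k ≤ r) {Δ : ℝ}
    (hΔ : ∀ᵐ w ∂freqMeasure, Δ ≤ lam k w) :
    2 * Real.pi * (k * Δ) ≤ ∫ w in freq, ∑ j ∈ Finset.Icc 1 r, lam j w := by
  rw [← integral_freq_const]
  refine integral_mono_ae (integrable_const _) (h.integrableOn_sum_lam hf le_rfl le_rfl) ?_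
  filter_upwards [hΔ, h.antitone, h.pos] with w hw hanti hpos
  calc (k : ℝ) * Δ = ∑ _j ∈ Finset.Icc 1 k, Δ := by simp
    _ ≤ ∑ j ∈ Finset.Icc 1 k, lam j w := Finset.sum_le_sum fun j hj =>
        hw.trans (hanti j k (Finset.mem_Icc.1 hj).1 (Finset.mem_Icc.1 hj).2 hk)
    _ ≤ ∑ j ∈ Finset.Icc 1 r, lam j w := Finset.sum_le_sum_of_subset_of_nonneg
        (Finset.Icc_subset_Icc_right hk) fun j hj _ =>
          (hpos j (Finset.mem_Icc.1 hj).1 (Finset.mem_Icc.1 hj).2).le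

theorem pos_of_ae_lam_le (h : IsSpectralDecomposition r f lam U) {j : ℕ} (hj : 1 ≤ j)
    (hjr : j ≤ r) {ε : ℝ} (hε : ∀ᵐ w ∂freqMeasure, lam j w ≤ ε) : 0 < ε := by
  have := neBot_ae_freqMeasure
  obtain ⟨w, hw, hpos⟩ := (hε.and h.pos).exists
  exact (hpos j hj hjr).trans_le hw

theorem integral_sum_tail_div_le (h : IsSpectralDecomposition r f lam U)
    (hf : ∀ a b, IntegrableOn (fun w => f w a b) freq) (hk : 1 ≤ k) (hkr : k ≤ r) {Δ ε : ℝ}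
    (hεΔ : ε < Δ) (hgap : ∀ᵐ w ∂freqMeasure, Δ ≤ lam k w ∧ lam (k + 1) w ≤ ε) :
    (∫ w in freq, ∑ j ∈ Finset.Icc (k + 1) r, lam j w) /
      ∫ w in freq, ∑ j ∈ Finset.Icc 1 r, lam j w ≤ ((r : ℝ) - k) * ε / (k * Δ) := by
  rcases hkr.eq_or_lt with rfl | hlt
  · simp
  have hε : 0 < ε := h.pos_of_ae_lam_le (Nat.le_add_left 1 k) hlt (hgap.mono fun _ hw => hw.2)
  have hkΔ : 0 < (k : ℝ) * Δ := mul_pos (by exact_mod_cast hk) (hε.trans hεΔ)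
  have hrk : 0 ≤ (r : ℝ) - k := sub_nonneg.2 (by exact_mod_cast hkr)
  calc _ ≤ 2 * Real.pi * (((r : ℝ) - k) * ε) / (2 * Real.pi * (k * Δ)) :=
        div_le_div₀ (by positivity) (h.integral_sum_tail_le hf hkr (hgap.mono fun _ hw => hw.2))
          (by positivity) (h.le_integral_sum hf hkr (hgap.mono fun _ hw => hw.1))
    _ = ((r : ℝ) - k) * ε / (k * Δ) := mul_div_mul_left _ _ (by positivity)

end IsSpectralDecomposition

end Decomposition

section Approximation

variable {Ω : Type*} [MeasurableSpace Ω] {P : Measure Ω} {d r k : ℕ}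
  {f T : ℝ → Matrix (Fin d) (Fin d) ℂ} {lam : ℕ → ℝ → ℝ} {U : ℝ → Matrix (Fin d) (Fin r) ℂ}
  {Z : VectorMeasure ℝ (L2Vec P d)} {X Y : ℤ → L2Vec P d}

theorem IsFactor.isSpectralDensity_sub {n : Type*} [Fintype n] {M : ℝ → Matrix (Fin d) n ℂ}
    (hM : IsFactor freqMeasure f M) (hZ : IsCramerMeasure X f Z) (hY : IsFiltered f Z T Y) :
    IsSpectralDensity (fun t => X t - Y t) fun w => (1 - T w) * f w * (1 - T w)ᴴ :=
  hM.isSpectralDensity_of_isFiltered hZ.cov_eq (hM.isFiltered_sub hZ.cov_eq hZ.represents hY)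

theorem IsFactor.ae_rank_le {n : Type*} [Fintype n] {M : ℝ → Matrix (Fin d) n ℂ}
    (hM : IsFactor freqMeasure f M) (hZ : IsCramerMeasure X f Z) (hY : IsFiltered f Z T Y)
    (hrank : (∃ g, IsSpectralDensity Y g ∧ ∀ᵐ w ∂freqMeasure, (g w).rank ≤ k) ∨
      ∀ᵐ w ∂freqMeasure, (T w).rank ≤ k) :
    ∀ᵐ w ∂freqMeasure, (T w * f w * (T w)ᴴ).rank ≤ k := by
  rcases hrank with ⟨g, hg, hgk⟩ | hT
  · filter_upwards [ae_eq_of_isSpectralDensity hg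
      (hM.isSpectralDensity_of_isFiltered hZ.cov_eq hY), hgk] with w hw hwk
    rwa [← hw]
  · filter_upwards [hT] with w hw
    exact (Matrix.rank_mul_le_left _ _).trans ((Matrix.rank_mul_le_left _ _).trans hw)

namespace IsSpectralDecomposition

theorem norm_sq_eq_integral (h : IsSpectralDecomposition r f lam U) (hf : IsSpectralDensity X f)
    (t : ℤ) : ‖X t‖ ^ 2 = ∫ w in freq, ∑ j ∈ Finset.Icc 1 r, lam j w :=
  (norm_sq_eq_integral_re_trace hf t).trans (integral_congr_ae h.re_trace_eq)

theorem norm_pos (h : IsSpectralDecomposition r f lam U) (hf : IsSpectralDensity X f)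
    (hr : 1 ≤ r) (t : ℤ) : 0 < ‖X t‖ := by
  have hsq := h.norm_sq_eq_integral hf t ▸ h.integral_sum_lam_pos hf.integrable hr
  exact (norm_nonneg _).lt_of_ne' fun hzero => by simp [hzero] at hsq

theorem norm_sq_sub_projFilter (h : IsSpectralDecomposition r f lam U)
    (hf : ∀ a b, IntegrableOn (fun w => f w a b) freq) (hZ : IsCramerMeasure X f Z) (hk : k ≤ r)
    (hY : IsFiltered f Z (projFilter hk U) Y) (t : ℤ) :
    ‖X t - Y t‖ ^ 2 = ∫ w in freq, ∑ j ∈ Finset.Icc (k + 1) r, lam j w :=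
  (norm_sq_eq_integral_re_trace ((h.isFactor hf).isSpectralDensity_sub hZ hY) t).trans
    (integral_congr_ae (h.re_trace_one_sub_projFilter hk))

theorem integral_sum_tail_le_norm_sq_sub (h : IsSpectralDecomposition r f lam U)
    (hf : ∀ a b, IntegrableOn (fun w => f w a b) freq) (hZ : IsCramerMeasure X f Z) (hk : k ≤ r)
    (hY : IsFiltered f Z T Y) (hrank : ∀ᵐ w ∂freqMeasure, (T w * f w * (T w)ᴴ).rank ≤ k) (t : ℤ) :
    ∫ w in freq, ∑ j ∈ Finset.Icc (k + 1) r, lam j w ≤ ‖X t - Y t‖ ^ 2 := by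
  have hdens := (h.isFactor hf).isSpectralDensity_sub hZ hY
  rw [norm_sq_eq_integral_re_trace hdens t]
  exact integral_mono_ae (h.integrableOn_sum_lam hf (Nat.le_add_left 1 k) le_rfl)
    (integrableOn_trace_of_isSpectralDensity hdens).re (h.sum_tail_le_re_trace hk hrank)

theorem hasConstantRank_projFilter [IsFiniteMeasure P] (h : IsSpectralDecomposition r f lam U)
    (hf : ∀ a b, IntegrableOn (fun w => f w a b) freq) (hX : ∀ t, ∫ x, X t x ∂P = 0)
    (hZ : IsCramerMeasure X f Z) (hk : k ≤ r) (hY : IsFiltered f Z (projFilter hk U) Y) :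
    HasConstantRank Y k := by
  have hdens := (h.isFactor hf).isSpectralDensity_of_isFiltered hZ.cov_eq hY
  exact ⟨isStationary_of_isSpectralDensity hdens
    ((h.isFactor hf).integral_eq_zero_of_isFiltered hZ hX hY), _, hdens,
    h.rank_projFilter_mul_mul hk⟩

end IsSpectralDecomposition

end Approximation

end RankReduction

open RankReduction

theorem mainTheorem5 {Ω : Type*} [MeasurableSpace Ω] (P : Measure Ω) [IsProbabilityMeasure P]
    (d r k : ℕ) (hr : 1 ≤ r) (hrd : r ≤ d) (hk : 1 ≤ k) (hkr : k ≤ r)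
    (X : ℤ → RankReduction.L2Vec P d) (hX : RankReduction.IsStationary X)
    (f : ℝ → Matrix (Fin d) (Fin d) ℂ) (hf : RankReduction.IsSpectralDensity X f)
    (hrank : ∀ᵐ w ∂(volume.restrict RankReduction.freq), (f w).rank = r)
    (lam : ℕ → ℝ → ℝ) (U : ℝ → Matrix (Fin d) (Fin r) ℂ)
    (hdec : RankReduction.IsSpectralDecomposition r f lam U) :
    -- Cramér's representation of `X` exists, with a unique random measure `Z`
    (∃! Z, RankReduction.IsCramerMeasure X f Z) ∧
    ∀ Z, RankReduction.IsCramerMeasure X f Z →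
      -- the filtered process is well defined
      (∃! Xk, RankReduction.IsFiltered f Z (RankReduction.projFilter hkr U) Xk) ∧
      ∀ Xk, RankReduction.IsFiltered f Z (RankReduction.projFilter hkr U) Xk →
        -- (a) it has constant rank `k` and minimizes the mean square error
        (RankReduction.HasConstantRank Xk k ∧
          (∀ᵐ w ∂(volume.restrict RankReduction.freq),
            (RankReduction.projFilter hkr U w).rank = k) ∧
          ∀ T Y, RankReduction.IsFiltered f Z T Y →
            ((∃ g, RankReduction.IsSpectralDensity Y g ∧
                ∀ᵐ w ∂(volume.restrict RankReduction.freq), (g w).rank ≤ k) ∨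
              ∀ᵐ w ∂(volume.restrict RankReduction.freq), (T w).rank ≤ k) →
            ∀ t, ‖X t - Xk t‖ ^ 2 ≤ ‖X t - Y t‖ ^ 2) ∧
        -- (b) the error and the relative error
        (IntegrableOn (fun w => ∑ j ∈ Finset.Icc 1 r, lam j w) RankReduction.freq ∧
          IntegrableOn (fun w => ∑ j ∈ Finset.Icc (k + 1) r, lam j w) RankReduction.freq ∧
          ∀ t, ‖X t - Xk t‖ ^ 2 =
              ∫ w in RankReduction.freq, ∑ j ∈ Finset.Icc (k + 1) r, lam j w ∧
            0 < ‖X t‖ ∧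
            ‖X t - Xk t‖ ^ 2 / ‖X t‖ ^ 2 =
              (∫ w in RankReduction.freq, ∑ j ∈ Finset.Icc (k + 1) r, lam j w) /
                ∫ w in RankReduction.freq, ∑ j ∈ Finset.Icc 1 r, lam j w) ∧
        -- (c) the bounds under an eigenvalue gap
        ∀ Δ ε : ℝ, ε < Δ →
          (∀ᵐ w ∂(volume.restrict RankReduction.freq), Δ ≤ lam k w ∧ lam (k + 1) w ≤ ε) →
          ∀ t, ‖X t - Xk t‖ ≤ Real.sqrt (2 * Real.pi * ((r : ℝ) - k) * ε) ∧
            ‖X t - Xk t‖ / ‖X t‖ ≤ Real.sqrt (((r : ℝ) - k) * ε / (k * Δ)) := by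
  have hM := hdec.isFactor hf.integrable
  refine ⟨hM.existsUnique_isCramerMeasure hf, fun Z hZ =>
    ⟨hM.existsUnique_isFiltered hZ.cov_eq (hdec.aemeasurable_projFilter hkr)
      (hdec.specNormSq_projFilter_ne_top hf.integrable hkr), fun Xk hXk => ?_⟩⟩
  have herr := hdec.norm_sq_sub_projFilter hf.integrable hZ hkr hXk
  have hnorm := hdec.norm_sq_eq_integral hf
  refine ⟨⟨hdec.hasConstantRank_projFilter hf.integrable hX.mean_zero hZ hkr hXk,
      hdec.rank_projFilter hkr, fun T Y hY hYk t => ?_⟩,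
    ⟨hdec.integrableOn_sum_lam hf.integrable le_rfl le_rfl,
      hdec.integrableOn_sum_lam hf.integrable (Nat.le_add_left 1 k) le_rfl, fun t =>
      ⟨herr t, hdec.norm_pos hf hr t, by rw [herr, hnorm]⟩⟩,
    fun Δ ε hεΔ hgap t => ⟨?_, ?_⟩⟩
  · exact (herr t).trans_le
      (hdec.integral_sum_tail_le_norm_sq_sub hf.integrable hZ hkr hY (hM.ae_rank_le hZ hY hYk) t)
  · refine Real.le_sqrt_of_sq_le ?_
    rw [herr, mul_assoc (2 * Real.pi)]
    exact hdec.integral_sum_tail_le hf.integrable hkr (hgap.mono fun _ hw => hw.2)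
  · refine Real.le_sqrt_of_sq_le ?_
    rw [div_pow, herr, hnorm]
    exact hdec.integral_sum_tail_div_le hf.integrable hk hkr hεΔ hgap
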